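/- All graphs are finite, undirected and simple. For an integer $k$, in the zero-visibility $k$-search game on a graph $G$ an invisible intruder first chooses a vertex; then, alternately, the searcher inspects a set of at most $k$ vertices (winning if the intruder is at one of them) and the intruder stays where it is or moves to an adjacent vertex. The searcher receives no other information, and a winning strategy for the searcher is a finite sequence of inspected sets that catches the intruder regardless of its starting vertex and its moves. The inspection number $\mathsf{in}(G)$ is the least $k$ for which the searcher has a winning strategy. A subdivision of $G$ is a graph obtained from $G$ by replacing its edges by internally disjoint paths (of length at least $1$) between the same end vertices. The topological inspection number $\mathsf{in}_t(G)$ is the least $k$ such that every subdivision $H$ of $G$ has a further subdivision $H'$ (that is, a subdivision $H'$ of $H$) with $\mathsf{in}(H') \le k$. **Proposition.** For every integer $n \ge 0$, the complete graph $K_n$ on $n$ vertices satisfies $$\mathsf{in}_t(K_n) \le \left\lceil \frac{n}{3} \right\rceil + 2 .$$ In particular, $\mathsf{in}_t(K_5) = \mathsf{in}_t(K_6) = 4$. -/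

import Mathlib

namespace InspectionGame

universe u v

/-- A possible trajectory of the intruder on `G`: `x t` is the position at the moment of the
searcher's inspection number `t`; between two inspections the intruder stays or moves to a
neighbour. -/
def IsTrajectory {V : Type u} (G : SimpleGraph V) (x : ℕ → V) : Prop :=
  ∀ t, x (t + 1) = x t ∨ G.Adj (x t) (x (t + 1))

/-- A finite sequence of inspected sets is winning if it catches the invisible intruder whatever
its starting vertex and its moves are. -/
def IsWinning {V : Type u} (G : SimpleGraph V) {l : ℕ} (S : Fin l → Finset V) : Prop :=
  ∀ x : ℕ → V, IsTrajectory G x → ∃ t : Fin l, x t ∈ S t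

/-- The searcher wins the zero-visibility `k`-search game on `G`. -/
def SearcherWins {V : Type u} (G : SimpleGraph V) (k : ℕ) : Prop :=
  ∃ (l : ℕ) (S : Fin l → Finset V), (∀ t, (S t).card ≤ k) ∧ IsWinning G S

/-- The inspection number: the least `k` for which the searcher wins the `k`-search game
(`⊤` if there is none, which does not happen on a finite graph). -/
noncomputable def inspectionNumber {V : Type u} (G : SimpleGraph V) : ℕ∞ :=
  ⨅ (k : ℕ) (_ : SearcherWins G k), (k : ℕ∞)

/-- The data exhibiting `H` as a subdivision of `G`: every edge `uv` of `G` is replaced by a path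
of `H` between the branch vertices of `u` and `v`; these paths are internally disjoint, avoid the
other branch vertices, and together with the branch vertices they make up all of `H`. -/
structure Subdivision {V : Type u} {W : Type v} (G : SimpleGraph V) (H : SimpleGraph W) where
  branch : V ↪ W
  path : ∀ {a b : V}, G.Adj a b → H.Walk (branch a) (branch b)
  isPath : ∀ {a b : V} (h : G.Adj a b), (path h).IsPath
  path_symm : ∀ {a b : V} (h : G.Adj a b), path h.symm = (path h).reverse
  branch_mem : ∀ {a b : V} (h : G.Adj a b) (c : V),
    branch c ∈ (path h).support → c = a ∨ c = b
  internally_disjoint : ∀ {a b c d : V} (h : G.Adj a b) (h' : G.Adj c d) (x : W),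
    s(a, b) ≠ s(c, d) → x ∈ (path h).support → x ∈ (path h').support → x ∈ Set.range branch
  cover_vertices : ∀ x : W,
    x ∈ Set.range branch ∨ ∃ (a b : V) (h : G.Adj a b), x ∈ (path h).support
  cover_edges : ∀ e ∈ H.edgeSet, ∃ (a b : V) (h : G.Adj a b), e ∈ (path h).edges

/-- `H` is a subdivision of `G`. -/
def IsSubdivision {V : Type u} {W : Type v} (H : SimpleGraph W) (G : SimpleGraph V) : Prop :=
  Nonempty (Subdivision G H)

/-- Every finite subdivision `H` of `G` has a further subdivision `H'` whose inspection number is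
at most `k`. -/
def HasSearchableSubdivisions {V : Type u} (G : SimpleGraph V) (k : ℕ∞) : Prop :=
  ∀ (W : Type u) [Finite W] (H : SimpleGraph W), IsSubdivision H G →
    ∃ (W' : Type u) (_ : Finite W') (H' : SimpleGraph W'),
      IsSubdivision H' H ∧ inspectionNumber H' ≤ k

/-- The topological inspection number of `G`: the least `k` such that every subdivision of `G`
has a further subdivision of inspection number at most `k`. -/
noncomputable def topInspectionNumber {V : Type u} (G : SimpleGraph V) : ℕ∞ :=
  sInf {k : ℕ∞ | HasSearchableSubdivisions G k}

end InspectionGame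

/-!
The searcher's possible information is the set `C` of vertices where the intruder can still be;
an inspection of `S` and the next move turn `C` into the closed neighbourhood of `C \ S`. Both bounds follow this
set on a graph in which every edge `ab` of the complete graph is a path with coordinates
`pos a b t` (`Net`).

*Lower bound.* No subdivision of `K₅` can be searched with three inspections per round
(`Net.not_searcherWins`). Let `e`, `f`, `g` be the three longest paths, and let `d` be an end of `e`
that is not an end of `f`. Keep all paths except `e`, and of `e` only an initial segment at `d`
whose length is the difference of the lengths of `f` and `g`. Since `K₅` minus an edge is
3-connected, two vertices can cut off only part of one path, or part of the segment together with
part of a path at `d`, hence at most as much as the interior of `f` (`Net.card_le_of_separated`,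
`Net.not_separated`). The kept graph has more than twice as many vertices. So if `f` has `L`
interior vertices, a set of more than `L` kept vertices has enough outer neighbours to have at
least `L + 4` vertices in its closed neighbourhood, and the number of contaminated vertices never
drops below `L + 4` (`Net.expansion`, `not_searcherWins_of_expansion`).

*Upper bound.* A given subdivision of `K_n` is subdivided further so that the lengths of the
paths grow fast with respect to a suitable order (`Net.exists_refinement`, `lowerSum_geometric`).
Split the vertices into groups `A`, `B`, `C` of at most `⌈n/3⌉` vertices. Inspecting all branch
vertices of a group blocks them, and two more inspections per round push the boundary of the clean
part along a path at speed one (`Net.forces_sweep`). Guarding `A`, the searcher cleans the paths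
inside `A` and, longest first, the paths from `A` to `B` and `C` up to their last vertex. Then no
dirt reaches `A` for a time of the order of the lengths of these paths, and the guards can move to
`B`. While they are there, the paths from `A` to `B` are finished, shortest first, and the paths
from `B` to `C` are cleaned up to their last vertex; at last the guards move to `C`
(`Setting.forces_phase`). This works because the paths from `A` to `C` are the longest ones,
so that they stay clean near `A` while `B` is guarded (`searcherWins_of_groups`).
-/

namespace InspectionGame

universe u v w

/-! ### Coordinates on subdivisions -/

/-- Coordinates on a graph `H` that contains a subdivision of `G`: `br a` is the branch vertex of
`a`, the edge `ab` of `G` is replaced by a path of length `len a b`, and `pos a b t` is the vertex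
at distance `t` from `br a` along that path. The values of `len` and `pos` at non-adjacent
pairs carry no information. -/
structure Net {V : Type u} {W : Type v} (G : SimpleGraph V) (H : SimpleGraph W) where
  br : V → W
  len : V → V → ℕ
  pos : V → V → ℕ → W
  br_inj : Function.Injective br
  len_pos : ∀ {a b}, G.Adj a b → 0 < len a b
  len_symm : ∀ a b, len a b = len b a
  pos_zero : ∀ {a b}, G.Adj a b → pos a b 0 = br a
  pos_symm : ∀ {a b t}, G.Adj a b → t ≤ len a b → pos b a (len a b - t) = pos a b t
  adj : ∀ {a b t}, G.Adj a b → t < len a b → H.Adj (pos a b t) (pos a b (t + 1))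
  br_ne : ∀ {a b t} (c), G.Adj a b → 0 < t → t < len a b → pos a b t ≠ br c
  inj : ∀ {a b c d t s}, G.Adj a b → G.Adj c d → 0 < t → t < len a b → s ≤ len c d →
    pos a b t = pos c d s → (c = a ∧ d = b ∧ s = t) ∨ (c = b ∧ d = a ∧ s + t = len a b)

/-- The subdivision described by the coordinates is all of `H`. -/
structure Net.Covers {V : Type u} {W : Type v} {G : SimpleGraph V} {H : SimpleGraph W}
    (N : Net G H) : Prop where
  vertex : ∀ x, (∃ a, x = N.br a) ∨
    ∃ a b t, G.Adj a b ∧ 0 < t ∧ t < N.len a b ∧ x = N.pos a b t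
  edge : ∀ {x y}, H.Adj x y →
    ∃ a b t, G.Adj a b ∧ t < N.len a b ∧ x = N.pos a b t ∧ y = N.pos a b (t + 1)

section Net

variable {V : Type u} {W : Type v} {G : SimpleGraph V} {H : SimpleGraph W}

theorem Net.pos_len (N : Net G H) {a b : V} (h : G.Adj a b) : N.pos a b (N.len a b) = N.br b := by
  have := N.pos_symm (t := N.len a b) h le_rfl
  rw [← this, Nat.sub_self, N.pos_zero h.symm]

/-- Two positions on the same path coincide only if they are equal. -/
theorem Net.pos_injOn (N : Net G H) {a b : V} (h : G.Adj a b) :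
    Set.InjOn (N.pos a b) (Set.Iic (N.len a b)) := by
  have key : ∀ t s, t ≤ N.len a b → s ≤ N.len a b → 0 < t → t < N.len a b →
      N.pos a b t = N.pos a b s → t = s := by
    intro t s _ hs h0 h1 he
    rcases N.inj h h h0 h1 hs he with h' | h'
    · exact h'.2.2.symm
    · exact absurd h'.1 h.ne
  intro t ht s hs he
  simp only [Set.mem_Iic] at ht hs
  by_cases h1 : 0 < t ∧ t < N.len a b
  · exact key t s ht hs h1.1 h1.2 he
  by_cases h2 : 0 < s ∧ s < N.len a b
  · exact (key s t hs ht h2.1 h2.2 he.symm).symm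
  have ht' : t = 0 ∨ t = N.len a b := by omega
  have hs' : s = 0 ∨ s = N.len a b := by omega
  have hne : N.br a ≠ N.br b := fun hh => h.ne (N.br_inj hh)
  rcases ht' with rfl | rfl <;> rcases hs' with rfl | rfl
  · rfl
  · rw [N.pos_zero h, N.pos_len h] at he; exact absurd he hne
  · rw [N.pos_zero h, N.pos_len h] at he; exact absurd he.symm hne
  · rfl

/-- The position that equals a branch vertex is an end of the path. -/
theorem Net.eq_br (N : Net G H) {a b c : V} {t : ℕ} (h : G.Adj a b) (ht : t ≤ N.len a b)
    (he : N.pos a b t = N.br c) : (t = 0 ∧ c = a) ∨ (t = N.len a b ∧ c = b) := by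
  by_cases h1 : 0 < t ∧ t < N.len a b
  · exact absurd he (N.br_ne c h h1.1 h1.2)
  have ht' : t = 0 ∨ t = N.len a b := by omega
  rcases ht' with rfl | rfl
  · rw [N.pos_zero h] at he; exact Or.inl ⟨rfl, (N.br_inj he).symm⟩
  · rw [N.pos_len h] at he; exact Or.inr ⟨rfl, (N.br_inj he).symm⟩

open Classical in
/-- The coordinates given by the paths of a subdivision. -/
noncomputable def Subdivision.toNet (S : Subdivision G H) : Net G H where
  br := S.branch
  len a b := if h : G.Adj a b then (S.path h).length else 0
  pos a b t := if h : G.Adj a b then (S.path h).getVert t else S.branch a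
  br_inj := S.branch.injective
  len_pos {a b} h := by
    simp only [h, dite_true]
    by_contra h0
    exact h.ne (S.branch.injective
      (SimpleGraph.Walk.eq_of_length_eq_zero (p := S.path h) (by omega)))
  len_symm a b := by
    by_cases h : G.Adj a b
    · simp [h, h.symm, S.path_symm h]
    · have h' : ¬ G.Adj b a := fun hh => h hh.symm
      simp [h, h']
  pos_zero h := by simp [h]
  pos_symm {a b t} h ht := by
    simp only [h, dite_true] at ht
    simp only [h, h.symm, dite_true, S.path_symm h, SimpleGraph.Walk.getVert_reverse]
    congr 1; omega
  adj {a b t} h ht := by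
    simp only [h, dite_true] at ht ⊢
    exact SimpleGraph.Walk.adj_getVert_succ _ ht
  br_ne {a b t} c h h0 ht he := by
    simp only [h, dite_true] at ht he
    have hinj := (S.isPath h).getVert_injOn
    have hmem : S.branch c ∈ (S.path h).support := he ▸ SimpleGraph.Walk.getVert_mem_support _ _
    rcases S.branch_mem h c hmem with rfl | rfl
    · have := hinj (by simp; omega) (by simp) (he.trans (SimpleGraph.Walk.getVert_zero _).symm)
      omega
    · have := hinj (by simp; omega) (by simp) (he.trans (SimpleGraph.Walk.getVert_length _).symm)
      omega
  inj {a b c d t s} h h' h0 ht hs he := by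
    simp only [h, h', dite_true] at ht he hs ⊢
    have hinj := (S.isPath h).getVert_injOn
    by_cases hne : s(a, b) = s(c, d)
    · rw [Sym2.eq_iff] at hne
      rcases hne with ⟨rfl, rfl⟩ | ⟨rfl, rfl⟩
      · exact Or.inl ⟨rfl, rfl, (hinj (by simp; omega) (by simp; omega) he).symm⟩
      · rw [S.path_symm h, SimpleGraph.Walk.getVert_reverse] at he
        rw [S.path_symm h, SimpleGraph.Walk.length_reverse] at hs
        have := hinj (by simp; omega) (by simp) he
        exact Or.inr ⟨rfl, rfl, by omega⟩
    · exfalso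
      obtain ⟨e, hc⟩ := S.internally_disjoint h h' ((S.path h).getVert t) hne
        (SimpleGraph.Walk.getVert_mem_support _ _) (he ▸ SimpleGraph.Walk.getVert_mem_support _ _)
      have hmem : S.branch e ∈ (S.path h).support := hc ▸ SimpleGraph.Walk.getVert_mem_support _ _
      rcases S.branch_mem h e hmem with rfl | rfl
      · have := hinj (by simp; omega) (by simp)
          (hc.symm.trans (SimpleGraph.Walk.getVert_zero _).symm)
        omega
      · have := hinj (by simp; omega) (by simp)
          (hc.symm.trans (SimpleGraph.Walk.getVert_length _).symm)
        omega

theorem Subdivision.toNet_covers (S : Subdivision G H) : S.toNet.Covers where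
  vertex x := by
    rcases S.cover_vertices x with ⟨a, rfl⟩ | ⟨a, b, h, hx⟩
    · exact Or.inl ⟨a, rfl⟩
    · obtain ⟨t, rfl, ht⟩ := SimpleGraph.Walk.mem_support_iff_exists_getVert.1 hx
      rcases Nat.eq_zero_or_pos t with rfl | h0
      · exact Or.inl ⟨a, by simp [Subdivision.toNet]⟩
      rcases ht.eq_or_lt with rfl | ht
      · exact Or.inl ⟨b, by simp [Subdivision.toNet]⟩
      · exact Or.inr ⟨a, b, t, h, h0, by simpa [Subdivision.toNet, h] using ht,
          by simp [Subdivision.toNet, h]⟩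
  edge {x y} hxy := by
    obtain ⟨a, b, h, he⟩ := S.cover_edges s(x, y) hxy
    rw [← SimpleGraph.Walk.adj_toSubgraph_iff_mem_edges, SimpleGraph.Walk.toSubgraph_adj_iff] at he
    obtain ⟨t, he, ht⟩ := he
    have hlen : S.toNet.len a b = (S.path h).length := by simp [Subdivision.toNet, h]
    have hpos : ∀ t, S.toNet.pos a b t = (S.path h).getVert t := by simp [Subdivision.toNet, h]
    rw [Sym2.eq_iff] at he
    rcases he with ⟨rfl, rfl⟩ | ⟨rfl, rfl⟩
    · exact ⟨a, b, t, h, by omega, (hpos t).symm, (hpos _).symm⟩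
    · refine ⟨b, a, S.toNet.len a b - (t + 1), h.symm, ?_, ?_, ?_⟩
      · rw [← S.toNet.len_symm a b]; omega
      · rw [S.toNet.pos_symm h (by omega), hpos]
      · have : S.toNet.len a b - (t + 1) + 1 = S.toNet.len a b - t := by omega
        rw [this, S.toNet.pos_symm h (by omega), hpos]

/-- Restriction of the coordinates to a subgraph of `G`. -/
def Net.comap {V' : Type w} {G' : SimpleGraph V'} (N : Net G H) (f : V' → V)
    (hf : Function.Injective f) (hG : ∀ {a b}, G'.Adj a b → G.Adj (f a) (f b)) : Net G' H where
  br a := N.br (f a)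
  len a b := N.len (f a) (f b)
  pos a b := N.pos (f a) (f b)
  br_inj := N.br_inj.comp hf
  len_pos h := N.len_pos (hG h)
  len_symm a b := N.len_symm _ _
  pos_zero h := N.pos_zero (hG h)
  pos_symm h := N.pos_symm (hG h)
  adj h := N.adj (hG h)
  br_ne c h := N.br_ne (f c) (hG h)
  inj h h' h0 ht hs he := by
    rcases N.inj (hG h) (hG h') h0 ht hs he with ⟨h1, h2, h3⟩ | ⟨h1, h2, h3⟩
    · exact Or.inl ⟨hf h1, hf h2, h3⟩
    · exact Or.inr ⟨hf h1, hf h2, h3⟩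

end Net

/-! ### Lower bound: subdivisions of `K₅` -/

/-- If every subset `D` of `X` that has at least `K - k` elements has at least `K` elements of `X`
in its closed neighbourhood, then the set of possible positions of the intruder never drops below
`K` elements. -/
theorem not_searcherWins_of_expansion {W : Type v} {H : SimpleGraph W} {k K : ℕ} (X : Finset W)
    (hK : 0 < K) (hX : K ≤ X.card)
    (hexp : ∀ D ⊆ X, K ≤ D.card + k → ∀ B ⊆ X, D ⊆ B →
      (∀ x ∈ D, ∀ y ∈ X, H.Adj x y → y ∈ B) → K ≤ B.card) : ¬ SearcherWins H k := by
  classical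
  rintro ⟨l, S, hS, hwin⟩
  let C : ℕ → Finset W := fun t => X.filter fun x =>
    ∃ y, IsTrajectory H y ∧ y t = x ∧ ∀ i : Fin l, (i : ℕ) < t → y i ∉ S i
  have hC : ∀ t, t ≤ l → K ≤ (C t).card := by
    intro t
    induction t with
    | zero =>
      intro _
      have : C 0 = X := by
        apply Finset.filter_true_of_mem
        intro x _
        exact ⟨fun _ => x, fun _ => Or.inl rfl, rfl, fun i hi => absurd hi (by omega)⟩
      rw [this]; exact hX
    | succ t ih =>
      intro ht
      have ih := ih (by omega)
      let i₀ : Fin l := ⟨t, by omega⟩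
      have hstep : ∀ x ∈ C t \ S i₀, ∀ z ∈ X, (z = x ∨ H.Adj x z) → z ∈ C (t + 1) := by
        intro x hx z hz hxz
        obtain ⟨hxC, hxS⟩ := Finset.mem_sdiff.1 hx
        obtain ⟨_, y, hy, hyt, hyS⟩ := Finset.mem_filter.1 hxC
        refine Finset.mem_filter.2 ⟨hz, fun i => if i ≤ t then y i else z, ?_, by simp, ?_⟩
        · intro i
          rcases lt_trichotomy i t with h | h | h
          · have h1 : i + 1 ≤ t := h
            simpa [h1, h.le] using hy i
          · subst h; simpa [hyt] using hxz
          · have h1 : ¬ i + 1 ≤ t := by omega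
            have h2 : ¬ i ≤ t := by omega
            simp [h1, h2]
        · intro i hi
          have h1 : (i : ℕ) ≤ t := by omega
          simp only [h1, if_true]
          rcases h1.lt_or_eq with h | h
          · exact hyS i h
          · have : i = i₀ := Fin.ext h
            rw [this]
            simpa [i₀, hyt] using hxS
      refine hexp (C t \ S i₀) (Finset.sdiff_subset.trans (Finset.filter_subset _ _)) ?_
        (C (t + 1)) (Finset.filter_subset _ _) ?_ ?_
      · have := Finset.le_card_sdiff (S i₀) (C t)
        have := hS i₀
        omega
      · intro x hx
        exact hstep x hx x (Finset.mem_filter.1 (Finset.mem_sdiff.1 hx).1).1 (Or.inl rfl)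
      · intro x hx y hy hxy
        exact hstep x hx y hy (Or.inr hxy)
  have hl := hC l le_rfl
  obtain ⟨x, hx⟩ : (C l).Nonempty := Finset.card_pos.1 (by omega)
  obtain ⟨_, y, hy, _, hyS⟩ := Finset.mem_filter.1 hx
  obtain ⟨t, ht⟩ := hwin y hy
  exact hyS t t.2 ht

theorem exists_lt_not_and_succ {q : ℕ → Prop} {t : ℕ} (h0 : ¬ q 0) (ht : q t) :
    ∃ s < t, ¬ q s ∧ q (s + 1) := by
  induction t with
  | zero => exact absurd ht h0
  | succ t ih =>
    by_cases h : q t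
    · obtain ⟨s, hs, h1⟩ := ih h
      exact ⟨s, by omega, h1⟩
    · exact ⟨t, by omega, h, ht⟩

section Five

variable {W : Type v} {H : SimpleGraph W} (N : Net (⊤ : SimpleGraph (Fin 5)) H)

/-- The vertices of the subdivided `K₅` without the interior of the path `dc`, of which only the
first `m` interior vertices next to `d` are kept. -/
def Net.Kept (d c : Fin 5) (m : ℕ) (x : W) : Prop :=
  (∃ a, x = N.br a) ∨
  (∃ a b t, a ≠ b ∧ s(a, b) ≠ s(d, c) ∧ 0 < t ∧ t < N.len a b ∧ x = N.pos a b t) ∨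
  ∃ t, 0 < t ∧ t ≤ m ∧ x = N.pos d c t

variable {N}

theorem Net.kept_pos {d c : Fin 5} {m : ℕ} {a b : Fin 5} (hab : a ≠ b) (he : s(a, b) ≠ s(d, c))
    {t : ℕ} (ht : t ≤ N.len a b) : N.Kept d c m (N.pos a b t) := by
  rcases Nat.eq_zero_or_pos t with rfl | h0
  · exact Or.inl ⟨a, N.pos_zero hab⟩
  rcases ht.eq_or_lt with rfl | ht
  · exact Or.inl ⟨b, N.pos_len hab⟩
  · exact Or.inr (Or.inl ⟨a, b, t, hab, he, h0, ht, rfl⟩)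

theorem Net.kept_tail {d c : Fin 5} (hdc : d ≠ c) {m : ℕ} {t : ℕ} (ht : t ≤ m) :
    N.Kept d c m (N.pos d c t) := by
  rcases Nat.eq_zero_or_pos t with rfl | h0
  · exact Or.inl ⟨d, N.pos_zero hdc⟩
  · exact Or.inr (Or.inr ⟨t, h0, ht, rfl⟩)

/-- Walking from a point of `A` inside a path towards its end, one leaves `A` through `P`. -/
theorem Net.exists_exit {d c : Fin 5} {m : ℕ} {A P : Finset W}
    (hcl : ∀ x ∈ A, ∀ y, N.Kept d c m y → H.Adj x y → y ∈ A ∨ y ∈ P)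
    (hbr : ∀ a, N.br a ∉ A) {a b : Fin 5} (hab : a ≠ b) {t : ℕ} (ht : t ≤ N.len a b)
    (hk : ∀ s < t, N.Kept d c m (N.pos a b s)) (hA : N.pos a b t ∈ A) :
    ∃ s < t, N.pos a b s ∈ P := by
  obtain ⟨s, hs, h1, h2⟩ := exists_lt_not_and_succ (q := fun s => N.pos a b s ∈ A)
    (by rw [N.pos_zero hab]; exact hbr a) hA
  refine ⟨s, hs, ?_⟩
  rcases hcl _ h2 _ (hk s hs) (N.adj hab (by omega)).symm with h | h
  · exact absurd h h1
  · exact h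

theorem Net.exists_two_exits {d c : Fin 5} {m : ℕ} {A P : Finset W}
    (hcl : ∀ x ∈ A, ∀ y, N.Kept d c m y → H.Adj x y → y ∈ A ∨ y ∈ P)
    (hbr : ∀ a, N.br a ∉ A) {a b : Fin 5} (hab : a ≠ b) (he : s(a, b) ≠ s(d, c))
    {t : ℕ} (ht : t ≤ N.len a b) (hA : N.pos a b t ∈ A) :
    ∃ s₁ s₂, s₁ < t ∧ t < s₂ ∧ s₂ ≤ N.len a b ∧ N.pos a b s₁ ∈ P ∧ N.pos a b s₂ ∈ P := by
  obtain ⟨s₁, hs₁, h1⟩ := N.exists_exit hcl hbr hab ht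
    (fun s hs => N.kept_pos hab he (by omega)) hA
  rw [← N.pos_symm hab ht] at hA
  have hl := N.len_symm a b
  obtain ⟨s₂, hs₂, h2⟩ := N.exists_exit hcl hbr hab.symm (by omega)
    (fun s hs => N.kept_pos hab.symm (by rwa [Sym2.eq_swap]) (by omega)) hA
  refine ⟨s₁, N.len a b - s₂, hs₁, by omega, by omega, h1, ?_⟩
  rw [hl, N.pos_symm hab.symm (by omega)]
  exact h2

/-- A set without branch vertices that is separated from the rest by at most two vertices lies on
one path, or on the tail and one path at `d`. -/
theorem Net.card_le_of_separated {d c : Fin 5} (hdc : d ≠ c) {m L : ℕ}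
    (hm : m < N.len d c)
    (h1 : ∀ a b, a ≠ b → s(a, b) ≠ s(d, c) → N.len a b ≤ L + 1)
    (h2 : ∀ b, b ≠ d → b ≠ c → N.len d b + m ≤ L + 1) (h3 : m ≤ L)
    {A P : Finset W} (hP : P.card ≤ 2) (hA : ∀ x ∈ A, N.Kept d c m x)
    (hcl : ∀ x ∈ A, ∀ y, N.Kept d c m y → H.Adj x y → y ∈ A ∨ y ∈ P)
    (hbr : ∀ a, N.br a ∉ A) : A.card ≤ L := by
  classical
  have htail : ((Finset.Icc 1 m).image (N.pos d c)).card ≤ m :=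
    Finset.card_image_le.trans (by simp)
  have hint : ∀ a b, ((Finset.Ioo 0 (N.len a b)).image (N.pos a b)).card ≤ N.len a b - 1 :=
    fun a b => Finset.card_image_le.trans (by simp)
  by_cases hex : ∃ a b t, a ≠ b ∧ s(a, b) ≠ s(d, c) ∧ 0 < t ∧ t < N.len a b ∧ N.pos a b t ∈ A
  · obtain ⟨a, b, t, hab, he, ht0, ht, htA⟩ := hex
    obtain ⟨t₁, t₂, ht1, ht2, ht2', hp1, hp2⟩ := N.exists_two_exits hcl hbr hab he ht.le htA
    have hp : ∀ p ∈ P, ∃ t ≤ N.len a b, p = N.pos a b t := by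
      intro p hpP
      by_contra hcon
      push Not at hcon
      have hne : N.pos a b t₁ ≠ N.pos a b t₂ := fun h => by
        have := N.pos_injOn hab (by simp; omega) (by simp; omega) h
        omega
      have : ({p, N.pos a b t₁, N.pos a b t₂} : Finset W).card = 3 :=
        Finset.card_eq_three.2 ⟨_, _, _, hcon _ (by omega), hcon _ (by omega), hne, rfl⟩
      have hsub : ({p, N.pos a b t₁, N.pos a b t₂} : Finset W) ⊆ P := by
        intro x; simp only [Finset.mem_insert, Finset.mem_singleton]
        rintro (rfl | rfl | rfl) <;> assumption
      have := Finset.card_le_card hsub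
      omega
    have hmem : ∀ x ∈ A, x ∈ (Finset.Ioo 0 (N.len a b)).image (N.pos a b) ∨
        (x ∈ (Finset.Icc 1 m).image (N.pos d c) ∧ (d = a ∨ d = b)) := by
      intro x hx
      rcases hA x hx with ⟨v, rfl⟩ | ⟨a', b', t', hab', he', ht0', ht', rfl⟩ | ⟨t', ht0', ht', rfl⟩
      · exact absurd hx (hbr v)
      · left
        by_cases hs : s(a', b') = s(a, b)
        · rcases Sym2.eq_iff.1 hs with ⟨rfl, rfl⟩ | ⟨rfl, rfl⟩
          · exact Finset.mem_image_of_mem _ (by simp; omega)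
          · rw [← N.pos_symm hab' ht'.le]
            exact Finset.mem_image_of_mem _ (by rw [N.len_symm b' a']; simp; omega)
        · exfalso
          have hend : ∀ s ≤ N.len a' b', N.pos a' b' s ∈ P → s = 0 ∨ s = N.len a' b' := by
            intro s hs' hsP
            by_contra hcon
            obtain ⟨r, hr, hre⟩ := hp _ hsP
            rcases N.inj hab' hab (by omega) (by omega) hr hre with h | h
            · exact hs (by rw [h.1, h.2.1])
            · exact hs (by rw [h.1, h.2.1, Sym2.eq_swap])
          obtain ⟨s₁, s₂, h11, h12, h13, hq1, hq2⟩ :=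
            N.exists_two_exits hcl hbr hab' he' ht'.le hx
          have e1 : s₁ = 0 := by have := hend s₁ (by omega) hq1; omega
          have e2 : s₂ = N.len a' b' := by have := hend s₂ (by omega) hq2; omega
          rw [e1, N.pos_zero hab'] at hq1
          rw [e2, N.pos_len hab'] at hq2
          obtain ⟨r1, hr1, hr1e⟩ := hp _ hq1
          obtain ⟨r2, hr2, hr2e⟩ := hp _ hq2
          have f1 := N.eq_br hab hr1 hr1e.symm
          have f2 := N.eq_br hab hr2 hr2e.symm
          rcases f1 with ⟨_, rfl⟩ | ⟨_, rfl⟩ <;> rcases f2 with ⟨_, rfl⟩ | ⟨_, rfl⟩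
          · exact hab' rfl
          · exact hs rfl
          · exact hs Sym2.eq_swap
          · exact hab' rfl
      · right
        refine ⟨Finset.mem_image_of_mem _ (by simp; omega), ?_⟩
        obtain ⟨s, hs, hsP⟩ := N.exists_exit hcl hbr hdc (by omega)
          (fun s hs => N.kept_tail hdc (by omega)) hx
        obtain ⟨r, hr, hre⟩ := hp _ hsP
        rcases Nat.eq_zero_or_pos s with rfl | hs0
        · rw [N.pos_zero hdc] at hre
          rcases N.eq_br hab hr hre.symm with h | h
          · exact Or.inl h.2
          · exact Or.inr h.2
        · rcases N.inj hdc hab hs0 (by omega) hr hre with h | h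
          · exact absurd (by rw [h.1, h.2.1]) he
          · exact absurd (by rw [h.1, h.2.1, Sym2.eq_swap]) he
    by_cases hd : d = a ∨ d = b
    · have hsub : A ⊆ (Finset.Ioo 0 (N.len a b)).image (N.pos a b) ∪
          (Finset.Icc 1 m).image (N.pos d c) := fun x hx => by
        rcases hmem x hx with h | h
        · exact Finset.mem_union_left _ h
        · exact Finset.mem_union_right _ h.1
      have hc := (Finset.card_le_card hsub).trans (Finset.card_union_le _ _)
      have := hint a b
      have hpos := N.len_pos hab
      have hlen : N.len a b + m ≤ L + 1 := by
        rcases hd with rfl | rfl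
        · exact h2 b hab.symm (fun h => he (by rw [h]))
        · rw [N.len_symm]
          exact h2 a hab (fun h => he (by rw [h, Sym2.eq_swap]))
      omega
    · have hsub : A ⊆ (Finset.Ioo 0 (N.len a b)).image (N.pos a b) := fun x hx => by
        rcases hmem x hx with h | h
        · exact h
        · exact absurd h.2 hd
      have hc := Finset.card_le_card hsub
      have := hint a b
      have := h1 a b hab he
      omega
  · have hsub : A ⊆ (Finset.Icc 1 m).image (N.pos d c) := fun x hx => by
      rcases hA x hx with ⟨v, rfl⟩ | ⟨a', b', t', hab', he', ht0', ht', rfl⟩ | ⟨t', ht0', ht', rfl⟩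
      · exact absurd hx (hbr v)
      · exact absurd ⟨a', b', t', hab', he', ht0', ht', hx⟩ hex
      · exact Finset.mem_image_of_mem _ (by simp; omega)
    exact (Finset.card_le_card hsub).trans (htail.trans h3)

/-- `p` is an interior vertex of the route `u`–`x`–`w`. -/
def Net.OnRoute (N : Net (⊤ : SimpleGraph (Fin 5)) H) (u w x : Fin 5) (p : W) : Prop :=
  p = N.br x ∨ ∃ y t, (y = u ∨ y = w) ∧ 0 < t ∧ t < N.len x y ∧ p = N.pos x y t

theorem Net.OnRoute.unique {u w x y : Fin 5} {p : W} (hx : x ≠ u ∧ x ≠ w) (hy : y ≠ u ∧ y ≠ w)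
    (h : N.OnRoute u w x p) (h' : N.OnRoute u w y p) : x = y := by
  have ne : ∀ {x z : Fin 5}, x ≠ u ∧ x ≠ w → (z = u ∨ z = w) → x ≠ z := by
    rintro x z ⟨h1, h2⟩ (rfl | rfl) <;> assumption
  rcases h with rfl | ⟨z, t, hz, ht0, ht, rfl⟩ <;> rcases h' with h' | ⟨z', t', hz', ht0', ht', h'⟩
  · exact N.br_inj h'
  · exact absurd h'.symm (N.br_ne _ (ne hy hz') ht0' ht')
  · exact absurd h' (N.br_ne _ (ne hx hz) ht0 ht)
  · rcases N.inj (ne hx hz) (ne hy hz') ht0 ht ht'.le h' with h | h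
    · exact h.1.symm
    · exact absurd h.1 (ne hy hz)

theorem Net.OnRoute.ne_direct {u w x : Fin 5} {p : W} (hx : x ≠ u ∧ x ≠ w) (huw : u ≠ w)
    (h : N.OnRoute u w x p) {t : ℕ} (ht0 : 0 < t) (ht : t < N.len w u) : p ≠ N.pos w u t := by
  rintro rfl
  rcases h with h | ⟨y, s, hy, hs0, hs, h⟩
  · exact N.br_ne _ huw.symm ht0 ht h
  · have hxy : x ≠ y := by rcases hy with rfl | rfl <;> simp [hx]
    rcases N.inj huw.symm hxy ht0 ht hs.le h with h | h
    · exact hx.2 h.1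
    · exact hx.1 h.1

/-- In `K₅` without an edge any two vertices are joined by three internally disjoint routes, so
they are not separated by two vertices. -/
theorem Net.not_separated {d c : Fin 5} {m : ℕ} {D P : Finset W} (hP : P.card ≤ 2)
    (hcl : ∀ x ∈ D, ∀ y, N.Kept d c m y → H.Adj x y → y ∈ D ∨ y ∈ P) {u w : Fin 5}
    (hu : N.br u ∈ D) (hw : N.br w ∉ D) (hw' : N.br w ∉ P) : False := by
  classical
  have huw : u ≠ w := by rintro rfl; exact hw hu
  have cross : ∀ {u w : Fin 5}, u ≠ w → s(u, w) ≠ s(d, c) → N.br u ∈ D → N.br w ∉ D →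
      N.br w ∉ P → ∃ t, 0 < t ∧ t < N.len w u ∧ N.pos w u t ∈ P := by
    intro u w huw he hu hw hw'
    obtain ⟨s, hs, h1, h2⟩ := exists_lt_not_and_succ (q := fun s => N.pos w u s ∈ D)
      (t := N.len w u) (by rw [N.pos_zero huw.symm]; exact hw)
      (by rw [N.pos_len huw.symm]; exact hu)
    have hsP : N.pos w u s ∈ P := by
      rcases hcl _ h2 _ (N.kept_pos huw.symm (by rwa [Sym2.eq_swap]) hs.le)
        (N.adj huw.symm hs).symm with h | h
      · exact absurd h h1
      · exact h
    refine ⟨s, Nat.pos_of_ne_zero ?_, hs, hsP⟩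
    rintro rfl
    rw [N.pos_zero huw.symm] at hsP
    exact hw' hsP
  have route : ∀ x, x ≠ u ∧ x ≠ w → s(u, x) ≠ s(d, c) → s(x, w) ≠ s(d, c) →
      ∃ p ∈ P, N.OnRoute u w x p := by
    intro x hx h1 h2
    by_cases hxP : N.br x ∈ P
    · exact ⟨_, hxP, Or.inl rfl⟩
    by_cases hxD : N.br x ∈ D
    · obtain ⟨t, ht0, ht, htP⟩ := cross hx.2 h2 hxD hw hw'
      refine ⟨_, htP, Or.inr ⟨w, N.len w x - t, Or.inr rfl, by omega, ?_, ?_⟩⟩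
      · rw [N.len_symm x w]; omega
      · rw [N.pos_symm hx.2.symm ht.le]
    · obtain ⟨t, ht0, ht, htP⟩ := cross hx.1.symm h1 hu hxD hxP
      exact ⟨_, htP, Or.inr ⟨u, t, Or.inl rfl, ht0, ht, rfl⟩⟩
  have three : ∀ p q r, p ∈ P → q ∈ P → r ∈ P → p ≠ q → p ≠ r → q ≠ r → False := by
    intro p q r hp hq hr h1 h2 h3
    have h : ({p, q, r} : Finset W).card = 3 := Finset.card_eq_three.2 ⟨_, _, _, h1, h2, h3, rfl⟩
    have hsub : ({p, q, r} : Finset W) ⊆ P := by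
      intro x; simp only [Finset.mem_insert, Finset.mem_singleton]
      rintro (rfl | rfl | rfl) <;> assumption
    have := Finset.card_le_card hsub
    omega
  by_cases he : s(u, w) = s(d, c)
  · have hcard : 2 < (Finset.univ \ {u, w} : Finset (Fin 5)).card := by
      rw [Finset.card_sdiff_of_subset (Finset.subset_univ _), Finset.card_pair huw]; simp
    obtain ⟨x, hx, y, hy, z, hz, hxy, hxz, hyz⟩ := Finset.two_lt_card.1 hcard
    simp only [Finset.mem_sdiff, Finset.mem_univ, true_and, Finset.mem_insert,
      Finset.mem_singleton, not_or] at hx hy hz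
    have hr : ∀ x, x ≠ u ∧ x ≠ w → ∃ p ∈ P, N.OnRoute u w x p := fun x hx =>
      route x hx (by rw [← he]; simp [hx, huw]) (by rw [← he]; simp [hx, huw.symm])
    obtain ⟨p, hp, hp'⟩ := hr x hx
    obtain ⟨q, hq, hq'⟩ := hr y hy
    obtain ⟨r, hr, hr'⟩ := hr z hz
    exact three p q r hp hq hr (fun h => hxy (hp'.unique hx hy (h ▸ hq')))
      (fun h => hxz (hp'.unique hx hz (h ▸ hr'))) (fun h => hyz (hq'.unique hy hz (h ▸ hr')))
  · obtain ⟨t, ht0, ht, htP⟩ := cross huw he hu hw hw'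
    -- at most one further vertex is adjacent in `K₅` to `u` or `w` by the missing edge
    obtain ⟨y₀, hy₀⟩ : ∃ y₀, ∀ x, x ≠ u → x ≠ w → x ≠ y₀ →
        s(u, x) ≠ s(d, c) ∧ s(x, w) ≠ s(d, c) := by
      by_cases h1 : d = u ∨ d = w
      · refine ⟨c, fun x hxu hxw hx => ?_⟩
        simp only [ne_eq, Sym2.eq_iff]
        rcases h1 with rfl | rfl <;> grind
      · refine ⟨d, fun x hxu hxw hx => ?_⟩
        simp only [ne_eq, Sym2.eq_iff]
        grind
    have hcard : 1 < (Finset.univ \ {u, w, y₀} : Finset (Fin 5)).card := by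
      have h1 := Finset.card_le_three (a := u) (b := w) (c := y₀)
      have h2 := Finset.le_card_sdiff {u, w, y₀} (Finset.univ : Finset (Fin 5))
      simp only [Finset.card_univ, Fintype.card_fin] at h2
      omega
    obtain ⟨x, hx, y, hy, hxy⟩ := Finset.one_lt_card.1 hcard
    simp only [Finset.mem_sdiff, Finset.mem_univ, true_and, Finset.mem_insert,
      Finset.mem_singleton, not_or] at hx hy
    obtain ⟨p, hp, hp'⟩ := route x ⟨hx.1, hx.2.1⟩ (hy₀ x hx.1 hx.2.1 hx.2.2).1
      (hy₀ x hx.1 hx.2.1 hx.2.2).2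
    obtain ⟨q, hq, hq'⟩ := route y ⟨hy.1, hy.2.1⟩ (hy₀ y hy.1 hy.2.1 hy.2.2).1
      (hy₀ y hy.1 hy.2.1 hy.2.2).2
    exact three p q _ hp hq htP
      (fun h => hxy (hp'.unique ⟨hx.1, hx.2.1⟩ ⟨hy.1, hy.2.1⟩ (h ▸ hq')))
      (hp'.ne_direct ⟨hx.1, hx.2.1⟩ huw ht0 ht) (hq'.ne_direct ⟨hy.1, hy.2.1⟩ huw ht0 ht)

/-- A set `D` of more than `L` kept vertices has at least `L + 4` kept vertices in its closed
neighbourhood. -/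
theorem Net.expansion {d c : Fin 5} (hdc : d ≠ c) {m L : ℕ}
    (hm : m < N.len d c)
    (h1 : ∀ a b, a ≠ b → s(a, b) ≠ s(d, c) → N.len a b ≤ L + 1)
    (h2 : ∀ b, b ≠ d → b ≠ c → N.len d b + m ≤ L + 1) (h3 : m ≤ L)
    {X : Finset W} (hX : ∀ x, x ∈ X ↔ N.Kept d c m x) (hcard : 2 * L + 5 ≤ X.card)
    {D B : Finset W} (hD : D ⊆ X) (hDL : L < D.card) (hB : B ⊆ X) (hDB : D ⊆ B)
    (hnb : ∀ x ∈ D, ∀ y ∈ X, H.Adj x y → y ∈ B) : L + 4 ≤ B.card := by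
  classical
  by_contra hlt
  have hP : (B \ D).card ≤ 2 := by
    rw [Finset.card_sdiff_of_subset hDB]; omega
  have hclD : ∀ x ∈ D, ∀ y, N.Kept d c m y → H.Adj x y → y ∈ D ∨ y ∈ B \ D := by
    intro x hx y hy hxy
    have := hnb x hx y ((hX y).2 hy) hxy
    by_cases h : y ∈ D
    · exact Or.inl h
    · exact Or.inr (Finset.mem_sdiff.2 ⟨this, h⟩)
  have hclZ : ∀ x ∈ X \ B, ∀ y, N.Kept d c m y → H.Adj x y → y ∈ X \ B ∨ y ∈ B \ D := by
    intro x hx y hy hxy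
    obtain ⟨hxX, hxB⟩ := Finset.mem_sdiff.1 hx
    have hyX := (hX y).2 hy
    by_cases h : y ∈ B
    · refine Or.inr (Finset.mem_sdiff.2 ⟨h, fun hyD => hxB (hnb y hyD x hxX hxy.symm)⟩)
    · exact Or.inl (Finset.mem_sdiff.2 ⟨hyX, h⟩)
  obtain ⟨u, hu⟩ : ∃ u, N.br u ∈ D := by
    by_contra hcon
    push Not at hcon
    have := N.card_le_of_separated hdc hm h1 h2 h3 hP (fun x hx => (hX x).1 (hD hx)) hclD hcon
    omega
  obtain ⟨w, hw⟩ : ∃ w, N.br w ∈ X \ B := by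
    by_contra hcon
    push Not at hcon
    have := N.card_le_of_separated hdc hm h1 h2 h3 hP
      (fun x hx => (hX x).1 (Finset.mem_sdiff.1 hx).1) hclZ hcon
    rw [Finset.card_sdiff_of_subset hB] at this
    omega
  have hwB := (Finset.mem_sdiff.1 hw).2
  exact N.not_separated hP hclD hu (fun h => hwB (hDB h))
    (fun h => hwB (Finset.mem_sdiff.1 h).1)

/-- No graph containing a subdivision of `K₅` is searchable with three inspections per round. -/
theorem Net.not_searcherWins [Finite W] (N : Net (⊤ : SimpleGraph (Fin 5)) H) {k : ℕ}
    (hk : k ≤ 3) : ¬ SearcherWins H k := by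
  classical
  have := Fintype.ofFinite W
  -- `e`, `f`, `g` are the three longest paths, in this order
  obtain ⟨e, he, hemax⟩ := Finset.exists_max_image
    (Finset.univ.filter fun p : Fin 5 × Fin 5 => p.1 ≠ p.2) (fun p => N.len p.1 p.2)
    ⟨(0, 1), by simp⟩
  have hedge : ∀ S : Finset (Sym2 (Fin 5)), S.card ≤ 2 → (Finset.univ.filter
      fun p : Fin 5 × Fin 5 => p.1 ≠ p.2 ∧ s(p.1, p.2) ∉ S).Nonempty := by
    intro S hS
    by_contra hcon
    rw [Finset.not_nonempty_iff_eq_empty, Finset.filter_eq_empty_iff] at hcon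
    have hmem : ∀ a b : Fin 5, a ≠ b → s(a, b) ∈ S := fun a b hab => by
      have := hcon (Finset.mem_univ (a, b))
      push Not at this
      exact this hab
    have hsub : ({s(0, 1), s(0, 2), s(0, 3)} : Finset (Sym2 (Fin 5))) ⊆ S := by
      intro x; simp only [Finset.mem_insert, Finset.mem_singleton]
      rintro (rfl | rfl | rfl) <;> exact hmem _ _ (by decide)
    have := Finset.card_le_card hsub
    have h3 : ({s(0, 1), s(0, 2), s(0, 3)} : Finset (Sym2 (Fin 5))).card = 3 := by decide
    omega
  obtain ⟨f, hf, hfmax⟩ := Finset.exists_max_image _ (fun p => N.len p.1 p.2)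
    (hedge {s(e.1, e.2)} (by simp))
  obtain ⟨g, hg, hgmax⟩ := Finset.exists_max_image _ (fun p => N.len p.1 p.2)
    (hedge {s(e.1, e.2), s(f.1, f.2)} Finset.card_le_two)
  obtain ⟨e₁, e₂⟩ := e
  obtain ⟨f₁, f₂⟩ := f
  obtain ⟨g₁, g₂⟩ := g
  simp only [Finset.mem_filter, Finset.mem_univ, true_and, Finset.mem_singleton,
    Finset.mem_insert, not_or, Prod.forall] at he hf hg hemax hfmax hgmax
  obtain ⟨d, c, hdc, hdcs, hdf⟩ : ∃ d c, d ≠ c ∧ s(d, c) = s(e₁, e₂) ∧ d ≠ f₁ ∧ d ≠ f₂ := by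
    by_cases h : e₁ ≠ f₁ ∧ e₁ ≠ f₂
    · exact ⟨e₁, e₂, he, rfl, h⟩
    · refine ⟨e₂, e₁, Ne.symm he, Sym2.eq_swap, ?_, ?_⟩
      · rintro rfl; have := hf.2; simp only [Sym2.eq_iff] at this; grind
      · rintro rfl; have := hf.2; simp only [Sym2.eq_iff] at this; grind
  have hlenE : N.len d c = N.len e₁ e₂ := by
    rcases Sym2.eq_iff.1 hdcs with ⟨rfl, rfl⟩ | ⟨rfl, rfl⟩
    · rfl
    · exact N.len_symm _ _
  rw [← hdcs] at hf hg hfmax hgmax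
  rw [← hlenE] at hemax
  have hpf := N.len_pos (show (⊤ : SimpleGraph (Fin 5)).Adj f₁ f₂ from hf.1)
  have hpg := N.len_pos (show (⊤ : SimpleGraph (Fin 5)).Adj g₁ g₂ from hg.1)
  have hfe := hemax f₁ f₂ hf.1
  have hgf := hfmax g₁ g₂ ⟨hg.1, hg.2.1⟩
  -- with this `m` the tail and any path at `d` other than `e` are together no longer than `f`
  set m := N.len f₁ f₂ - N.len g₁ g₂ with hm
  set L := N.len f₁ f₂ - 1 with hL
  let X : Finset W := Finset.univ.filter (N.Kept d c m)
  have hX : ∀ x, x ∈ X ↔ N.Kept d c m x := by simp [X]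
  have hcard : 2 * L + 5 ≤ X.card := by
    have hinj : ∀ {a b : Fin 5} {T : Finset ℕ}, a ≠ b → (∀ t ∈ T, t ≤ N.len a b) →
        (T.image (N.pos a b)).card = T.card := fun hab hT =>
      Finset.card_image_of_injOn fun x hx y hy h => N.pos_injOn hab (hT x hx) (hT y hy) h
    have hdisj : ∀ {a b a' b' : Fin 5} {T T' : Finset ℕ}, a ≠ b → a' ≠ b' → s(a, b) ≠ s(a', b') →
        (∀ t ∈ T, 0 < t ∧ t < N.len a b) → (∀ t ∈ T', t ≤ N.len a' b') →
        Disjoint (T.image (N.pos a b)) (T'.image (N.pos a' b')) := by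
      intro a b a' b' T T' hab hab' hs hT hT'
      rw [Finset.disjoint_left]
      intro x hx hx'
      obtain ⟨t, ht, rfl⟩ := Finset.mem_image.1 hx
      obtain ⟨t', ht', h⟩ := Finset.mem_image.1 hx'
      rcases N.inj hab hab' (hT t ht).1 (hT t ht).2 (hT' t' ht') h.symm with h | h
      · exact hs (by rw [h.1, h.2.1])
      · exact hs (by rw [h.1, h.2.1, Sym2.eq_swap])
    have hdisjb : ∀ {a b : Fin 5} {T : Finset ℕ}, a ≠ b →
        (∀ t ∈ T, 0 < t ∧ t < N.len a b) →
        Disjoint (T.image (N.pos a b)) (Finset.univ.image N.br) := by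
      intro a b T hab hT
      rw [Finset.disjoint_left]
      intro x hx hx'
      obtain ⟨t, ht, rfl⟩ := Finset.mem_image.1 hx
      obtain ⟨v, _, h⟩ := Finset.mem_image.1 hx'
      exact N.br_ne v hab (hT t ht).1 (hT t ht).2 h.symm
    have hIf : ∀ t ∈ Finset.Ioo 0 (N.len f₁ f₂), 0 < t ∧ t < N.len f₁ f₂ := by simp
    have hIg : ∀ t ∈ Finset.Ioo 0 (N.len g₁ g₂), 0 < t ∧ t < N.len g₁ g₂ := by simp
    have hIt : ∀ t ∈ Finset.Icc 1 m, 0 < t ∧ t < N.len d c := by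
      intro t ht; simp only [Finset.mem_Icc] at ht; omega
    have hcard : (((Finset.Icc 1 m).image (N.pos d c) ∪
        ((Finset.Ioo 0 (N.len f₁ f₂)).image (N.pos f₁ f₂) ∪
        ((Finset.Ioo 0 (N.len g₁ g₂)).image (N.pos g₁ g₂) ∪ Finset.univ.image N.br)))).card =
        m + ((N.len f₁ f₂ - 1) + ((N.len g₁ g₂ - 1) + 5)) := by
      rw [Finset.card_union_of_disjoint, Finset.card_union_of_disjoint,
        Finset.card_union_of_disjoint, hinj hdc (fun t ht => (hIt t ht).2.le),
        hinj hf.1 (fun t ht => (hIf t ht).2.le), hinj hg.1 (fun t ht => (hIg t ht).2.le),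
        Finset.card_image_of_injective _ N.br_inj]
      · simp
      · exact hdisjb hg.1 hIg
      · rw [Finset.disjoint_union_right]
        exact ⟨hdisj hf.1 hg.1 (Ne.symm hg.2.2) hIf (fun t ht => (hIg t ht).2.le),
          hdisjb hf.1 hIf⟩
      · rw [Finset.disjoint_union_right, Finset.disjoint_union_right]
        exact ⟨hdisj hdc hf.1 (Ne.symm hf.2) hIt (fun t ht => (hIf t ht).2.le),
          hdisj hdc hg.1 (Ne.symm hg.2.1) hIt (fun t ht => (hIg t ht).2.le), hdisjb hdc hIt⟩
    have hsub : ((Finset.Icc 1 m).image (N.pos d c) ∪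
        ((Finset.Ioo 0 (N.len f₁ f₂)).image (N.pos f₁ f₂) ∪
        ((Finset.Ioo 0 (N.len g₁ g₂)).image (N.pos g₁ g₂) ∪ Finset.univ.image N.br))) ⊆ X := by
      intro x hx
      rw [hX]
      simp only [Finset.mem_union, Finset.mem_image] at hx
      rcases hx with ⟨t, ht, rfl⟩ | ⟨t, ht, rfl⟩ | ⟨t, ht, rfl⟩ | ⟨v, _, rfl⟩
      · exact N.kept_tail hdc (Finset.mem_Icc.1 ht).2
      · exact N.kept_pos hf.1 hf.2 (hIf t ht).2.le
      · exact N.kept_pos hg.1 hg.2.1 (hIg t ht).2.le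
      · exact Or.inl ⟨v, rfl⟩
    have := Finset.card_le_card hsub
    omega
  refine not_searcherWins_of_expansion (K := L + 4) X (by omega) (by omega) ?_
  intro D hD hDc B hB hDB hnb
  refine N.expansion hdc (m := m) (by omega) ?_ ?_ (by omega) hX hcard hD (by omega) hB hDB hnb
  · intro a b hab hs
    have := hfmax a b ⟨hab, hs⟩
    omega
  · intro b hbd hbc
    have := hgmax d b ⟨hbd.symm, by simp only [Sym2.eq_iff]; grind,
      by simp only [Sym2.eq_iff]; grind⟩
    omega

end Five

/-! ### Constructing subdivisions with prescribed lengths -/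

section Recover

variable {V : Type u} {W : Type v} {G : SimpleGraph V} {H : SimpleGraph W}

theorem Net.exists_walk (N : Net G H) {a b : V} (h : G.Adj a b) :
    ∃ p : H.Walk (N.br a) (N.br b), p.length = N.len a b ∧
      ∀ t ≤ N.len a b, p.getVert t = N.pos a b t := by
  have key : ∀ k ≤ N.len a b, ∀ y, y = N.pos a b k → ∃ p : H.Walk (N.br a) y, p.length = k ∧
      ∀ t ≤ k, p.getVert t = N.pos a b t := by
    intro k
    induction k with
    | zero =>
      rintro - y rfl
      rw [N.pos_zero h]
      refine ⟨.nil, rfl, fun t ht => ?_⟩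
      obtain rfl : t = 0 := by omega
      simp [N.pos_zero h]
    | succ k ih =>
      rintro hk y rfl
      obtain ⟨p, hp, hpt⟩ := ih (by omega) _ rfl
      refine ⟨p.append (.cons (N.adj h (by omega)) .nil), by simp [hp], fun t ht => ?_⟩
      rw [SimpleGraph.Walk.getVert_append']
      split_ifs with h1
      · exact hpt t (by omega)
      · obtain rfl : t = k + 1 := by omega
        simp [hp]
  exact key _ le_rfl _ (N.pos_len h).symm

/-- A graph that is all covered by coordinates over `G` is a subdivision of `G`. -/
theorem Net.isSubdivision (N : Net G H) (hN : N.Covers) : IsSubdivision H G := by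
  choose p hlen hpos using fun {a b : V} (h : G.Adj a b) => N.exists_walk h
  have hsupp : ∀ {a b : V} (h : G.Adj a b) (x : W), x ∈ (p h).support →
      ∃ t ≤ N.len a b, x = N.pos a b t := by
    intro a b h x hx
    obtain ⟨t, rfl, ht⟩ := SimpleGraph.Walk.mem_support_iff_exists_getVert.1 hx
    rw [hlen] at ht
    exact ⟨t, ht, hpos h t ht⟩
  refine ⟨⟨⟨N.br, N.br_inj⟩, p, ?_, ?_, ?_, ?_, ?_, ?_⟩⟩
  · intro a b h
    rw [← SimpleGraph.Walk.IsPath.getVert_injOn_iff]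
    intro t ht s hs hts
    simp only [hlen, Set.mem_ofPred_eq] at ht hs
    rw [hpos h t ht, hpos h s hs] at hts
    exact N.pos_injOn h ht hs hts
  · intro a b h
    refine SimpleGraph.Walk.ext_getVert_le_length (by simp [hlen, N.len_symm b a]) ?_
    intro t ht
    rw [hlen, N.len_symm] at ht
    rw [SimpleGraph.Walk.getVert_reverse, hlen, hpos h.symm t (by rwa [N.len_symm]),
      hpos h _ (by omega), ← N.pos_symm h (t := N.len a b - t) (by omega)]
    congr 1; omega
  · intro a b h c hc
    obtain ⟨t, ht, he⟩ := hsupp h _ hc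
    rcases N.eq_br h ht he.symm with h' | h'
    · exact Or.inl h'.2
    · exact Or.inr h'.2
  · intro a b c d h h' x hne hx hx'
    obtain ⟨t, ht, rfl⟩ := hsupp h _ hx
    obtain ⟨s, hs, he⟩ := hsupp h' _ hx'
    rcases Nat.eq_zero_or_pos t with rfl | h0
    · exact ⟨a, (N.pos_zero h).symm⟩
    rcases ht.eq_or_lt with rfl | ht
    · exact ⟨b, (N.pos_len h).symm⟩
    rcases N.inj h h' h0 ht hs he with h1 | h1
    · exact absurd (by rw [h1.1, h1.2.1]) hne
    · exact absurd (by rw [h1.1, h1.2.1, Sym2.eq_swap]) hne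
  · intro x
    rcases hN.vertex x with ⟨a, rfl⟩ | ⟨a, b, t, h, h0, ht, rfl⟩
    · exact Or.inl ⟨a, rfl⟩
    · exact Or.inr ⟨a, b, h, hpos h t ht.le ▸ SimpleGraph.Walk.getVert_mem_support _ _⟩
  · intro e he
    induction e using Sym2.ind with
    | _ x y =>
      obtain ⟨a, b, t, h, ht, rfl, rfl⟩ := hN.edge he
      refine ⟨a, b, h, ?_⟩
      rw [SimpleGraph.Walk.mk_mem_edges_iff_exists]
      exact ⟨t, by rwa [hlen], by rw [hpos h t ht.le, hpos h (t + 1) ht]⟩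

end Recover

section Model

variable {V : Type u} [LinearOrder V] (G : SimpleGraph V) (l : V → V → ℕ)

open Classical in
/-- The label of the vertex at distance `t` from `a` on the path of length `l a b` that replaces
the edge `ab`: an end vertex, or an interior vertex, which is labelled from the smaller end. -/
noncomputable def modelCode (a b : V) (t : ℕ) : V ⊕ V × V × ℕ :=
  if ¬ G.Adj a b ∨ t = 0 then .inl a
  else if l a b ≤ t then .inl b
  else if a < b then .inr (a, b, t)
  else .inr (b, a, l a b - t)

/-- The vertices of the subdivision of `G` in which the edge `ab` becomes a path of length
`l a b`. -/
def ModelVertex : Type u := {x : V ⊕ V × V × ℕ // ∃ a b t, modelCode G l a b t = x}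

variable {G l}

/-- The vertex at distance `t` from `a` on the path that replaces the edge `ab`. -/
noncomputable def modelPos (a b : V) (t : ℕ) : ModelVertex G l :=
  ⟨modelCode G l a b t, a, b, t, rfl⟩

theorem modelPos_eq_iff {a b c d : V} {t s : ℕ} :
    (modelPos a b t : ModelVertex G l) = modelPos c d s ↔
      modelCode G l a b t = modelCode G l c d s := Subtype.ext_iff

instance [Finite V] : Finite (ModelVertex G l) := by
  refine Finite.of_surjective
    (fun q : Σ p : V × V, Fin (l p.1 p.2 + 2) => (modelPos q.1.1 q.1.2 q.2 : ModelVertex G l)) ?_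
  rintro ⟨x, a, b, t, rfl⟩
  by_cases h : t ≤ l a b
  · exact ⟨⟨(a, b), ⟨t, by simp only; omega⟩⟩, rfl⟩
  · refine ⟨⟨(a, b), ⟨l a b + 1, by simp⟩⟩, modelPos_eq_iff.2 ?_⟩
    have h1 : t ≠ 0 := by omega
    have h2 : l a b ≤ t := by omega
    by_cases h3 : G.Adj a b <;> simp [modelCode, h1, h2, h3]

theorem modelCode_zero (a b : V) : modelCode G l a b 0 = .inl a := by simp [modelCode]

theorem modelCode_interior {a b : V} {t : ℕ} (h : G.Adj a b) (h0 : 0 < t) (ht : t < l a b) :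
    modelCode G l a b t = if a < b then .inr (a, b, t) else .inr (b, a, l a b - t) := by
  have h1 : t ≠ 0 := by omega
  have h2 : ¬ l a b ≤ t := by omega
  simp [modelCode, h, h1, h2]

theorem modelCode_len {a b : V} (hl : 0 < l a b) (h : G.Adj a b) :
    modelCode G l a b (l a b) = .inl b := by
  have h1 : l a b ≠ 0 := by omega
  simp [modelCode, h, h1]

theorem modelCode_cases {a b : V} {t : ℕ} (hl : 0 < l a b) (h : G.Adj a b) (ht : t ≤ l a b) :
    (t = 0 ∧ modelCode G l a b t = .inl a) ∨ (t = l a b ∧ modelCode G l a b t = .inl b) ∨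
    (0 < t ∧ t < l a b ∧
      modelCode G l a b t = if a < b then .inr (a, b, t) else .inr (b, a, l a b - t)) := by
  rcases Nat.eq_zero_or_pos t with rfl | h0
  · exact Or.inl ⟨rfl, modelCode_zero a b⟩
  rcases ht.eq_or_lt with rfl | ht
  · exact Or.inr (Or.inl ⟨rfl, modelCode_len hl h⟩)
  · exact Or.inr (Or.inr ⟨h0, ht, modelCode_interior h h0 ht⟩)

theorem modelCode_symm (hs : ∀ a b, l a b = l b a) (hl : ∀ {a b}, G.Adj a b → 0 < l a b)
    {a b : V} {t : ℕ} (h : G.Adj a b) (ht : t ≤ l a b) :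
    modelCode G l b a (l a b - t) = modelCode G l a b t := by
  rcases modelCode_cases (hl h) h ht with ⟨rfl, h1⟩ | ⟨rfl, h1⟩ | ⟨h0, h0', h1⟩
  · rw [h1, Nat.sub_zero, hs, modelCode_len (hl h.symm) h.symm]
  · rw [h1, Nat.sub_self, modelCode_zero]
  · have := hs a b
    rw [h1, modelCode_interior h.symm (by omega) (by omega), ← hs]
    rcases lt_or_gt_of_ne h.ne with h2 | h2
    · simp only [h2, h2.not_gt, if_true, if_false, Sum.inr.injEq, Prod.mk.injEq, true_and]
      omega
    · simp [h2, h2.not_gt]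

theorem modelCode_inj {a b c d : V} {t s : ℕ}
    (hs : ∀ a b, l a b = l b a) (hl : ∀ {a b}, G.Adj a b → 0 < l a b)
    (h : G.Adj a b) (h' : G.Adj c d) (h0 : 0 < t)
    (ht : t < l a b) (hsl : s ≤ l c d) (he : modelCode G l a b t = modelCode G l c d s) :
    (c = a ∧ d = b ∧ s = t) ∨ (c = b ∧ d = a ∧ s + t = l a b) := by
  rw [modelCode_interior h h0 ht] at he
  have hab := hs a b
  rcases modelCode_cases (hl h') h' hsl with ⟨rfl, h1⟩ | ⟨rfl, h1⟩ | ⟨h0', ht', h1⟩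
  · rw [h1] at he; split_ifs at he
  · rw [h1] at he; split_ifs at he
  · rw [h1] at he
    split_ifs at he <;> simp only [Sum.inr.injEq, Prod.mk.injEq] at he <;>
      obtain ⟨rfl, rfl, h2⟩ := he <;> simp only [true_and] <;> omega

variable (G l) in
/-- The subdivision of `G` in which the edge `ab` becomes a path of length `l a b`. -/
def model (hs : ∀ a b, l a b = l b a) (hl : ∀ {a b}, G.Adj a b → 0 < l a b) :
    SimpleGraph (ModelVertex G l) where
  Adj x y := ∃ a b t, G.Adj a b ∧ t < l a b ∧ x = modelPos a b t ∧ y = modelPos a b (t + 1)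
  symm := ⟨by
    rintro x y ⟨a, b, t, h, ht, rfl, rfl⟩
    have hab := hs a b
    refine ⟨b, a, l a b - (t + 1), h.symm, by omega, ?_, ?_⟩
    · exact modelPos_eq_iff.2 (modelCode_symm hs hl h (by omega)).symm
    · have : l a b - (t + 1) + 1 = l a b - t := by omega
      rw [this]
      exact modelPos_eq_iff.2 (modelCode_symm hs hl h (by omega)).symm⟩
  loopless := ⟨by
    rintro x ⟨a, b, t, h, ht, h1, h2⟩
    have he := modelPos_eq_iff.1 (h1.symm.trans h2)
    rcases modelCode_cases (hl h) h ht.le with ⟨rfl, h3⟩ | ⟨rfl, h3⟩ | ⟨h0, _, h3⟩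
    · rw [h3] at he
      rcases modelCode_cases (hl h) h ht with ⟨h4, h5⟩ | ⟨h4, h5⟩ | ⟨h0, _, h5⟩
      · omega
      · rw [h5] at he; exact h.ne (Sum.inl.inj he)
      · rw [h5] at he; split_ifs at he
    · omega
    · rcases modelCode_inj hs hl h h h0 ht ht he with h4 | h4
      · omega
      · exact h.ne h4.1⟩

/-- The coordinates of the model. -/
noncomputable def modelNet (hs : ∀ a b, l a b = l b a) (hl : ∀ {a b}, G.Adj a b → 0 < l a b) :
    Net G (model G l hs hl) where
  br a := modelPos a a 0
  len := l
  pos := modelPos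
  br_inj a b h := by
    have := modelPos_eq_iff.1 h
    simpa [modelCode_zero] using this
  len_pos := hl
  len_symm := hs
  pos_zero _ := modelPos_eq_iff.2 (by rw [modelCode_zero, modelCode_zero])
  pos_symm h ht := modelPos_eq_iff.2 (modelCode_symm hs hl h ht)
  adj {a b t} h ht := ⟨a, b, t, h, ht, rfl, rfl⟩
  br_ne c h h0 ht he := by
    have := modelPos_eq_iff.1 he
    rw [modelCode_interior h h0 ht, modelCode_zero] at this
    split_ifs at this
  inj h h' h0 ht hs' he := modelCode_inj hs hl h h' h0 ht hs' (modelPos_eq_iff.1 he)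

theorem modelNet_covers (hs : ∀ a b, l a b = l b a) (hl : ∀ {a b}, G.Adj a b → 0 < l a b) :
    (modelNet hs hl).Covers where
  vertex := by
    rintro ⟨x, a, b, t, rfl⟩
    by_cases h : G.Adj a b
    · by_cases ht : t ≤ l a b
      · rcases modelCode_cases (hl h) h ht with ⟨rfl, h3⟩ | ⟨rfl, h3⟩ | ⟨h0, h1, h3⟩
        · exact Or.inl ⟨a, Subtype.ext (h3.trans (modelCode_zero a a).symm)⟩
        · exact Or.inl ⟨b, Subtype.ext (h3.trans (modelCode_zero b b).symm)⟩
        · exact Or.inr ⟨a, b, t, h, h0, h1, rfl⟩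
      · refine Or.inl ⟨b, Subtype.ext (Eq.trans ?_ (modelCode_zero b b).symm)⟩
        have h1 : t ≠ 0 := by omega
        have h2 : l a b ≤ t := by omega
        simp [modelCode, h, h1, h2]
    · exact Or.inl ⟨a, Subtype.ext (Eq.trans (by simp [modelCode, h]) (modelCode_zero a a).symm)⟩
  edge h := h

end Model

section Compose

variable {V : Type u} {W : Type v} {M : Type w} {G : SimpleGraph V} {H : SimpleGraph W}
  {K : SimpleGraph M}

/-- Two consecutive vertices of a path determine the path. -/
theorem Net.inj_succ (N : Net G H) {a b c d : V} {j i : ℕ} (h : G.Adj a b) (h' : G.Adj c d)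
    (hj : j < N.len a b) (hi : i < N.len c d) (h0 : N.pos a b j = N.pos c d i)
    (h1 : N.pos a b (j + 1) = N.pos c d (i + 1)) : c = a ∧ d = b ∧ i = j := by
  rcases Nat.eq_zero_or_pos j with rfl | hj0
  · rcases (show 0 + 1 ≤ N.len a b from hj).lt_or_eq with hlt | heq
    · rcases N.inj h h' (by omega) hlt (by omega) h1 with h2 | h2
      · exact ⟨h2.1, h2.2.1, by omega⟩
      · obtain ⟨rfl, rfl, h3⟩ := h2
        rw [N.pos_zero h] at h0
        rcases N.eq_br h' hi.le h0.symm with h4 | h4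
        · exact absurd h4.2 h.ne
        · omega
    · rw [N.pos_zero h] at h0
      rw [heq, N.pos_len h] at h1
      rcases N.eq_br h' hi.le h0.symm with h4 | h4
      · obtain ⟨rfl, rfl⟩ := h4
        rcases N.eq_br h' hi h1.symm with h5 | h5
        · omega
        · exact ⟨rfl, h5.2.symm, rfl⟩
      · omega
  · rcases N.inj h h' hj0 hj hi.le h0 with h2 | h2
    · exact h2
    · obtain ⟨rfl, rfl, h3⟩ := h2
      have hs := N.len_symm c d
      rw [← N.pos_symm h' (by omega : i + 1 ≤ _)] at h1
      have := N.pos_injOn h (by simp; omega) (by simp; omega) h1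
      omega

/-- Coordinates of a subdivision of a subdivision, at position `t` of the path `ab`, if all edges
of the path `ab` of the first subdivision are replaced by paths of length `c`. -/
noncomputable def compPos (N₁ : Net G H) (N₂ : Net H K) (a b : V) (c t : ℕ) : M :=
  if t % c = 0 then N₂.br (N₁.pos a b (t / c))
  else N₂.pos (N₁.pos a b (t / c)) (N₁.pos a b (t / c + 1)) (t % c)

variable {N₁ : Net G H} {N₂ : Net H K} {c : V → V → ℕ}

theorem compPos_mul (a b : V) {c : ℕ} (hc : 0 < c) (j : ℕ) :
    compPos N₁ N₂ a b c (j * c) = N₂.br (N₁.pos a b j) := by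
  simp [compPos, Nat.mul_div_cancel _ hc]

theorem compPos_mul_add {a b : V} {c : ℕ} (h : G.Adj a b) {j r : ℕ} (hj : j < N₁.len a b)
    (hlen : N₂.len (N₁.pos a b j) (N₁.pos a b (j + 1)) = c) (hr : r ≤ c) :
    compPos N₁ N₂ a b c (j * c + r) = N₂.pos (N₁.pos a b j) (N₁.pos a b (j + 1)) r := by
  have hadj := N₁.adj h hj
  have hc : 0 < c := hlen ▸ N₂.len_pos hadj
  rcases Nat.eq_zero_or_pos r with rfl | h0
  · rw [N₂.pos_zero hadj, Nat.add_zero, compPos_mul a b hc]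
  rcases hr.eq_or_lt with rfl | hr
  · have : j * r + r = (j + 1) * r := by ring
    rw [this, compPos_mul a b hc]
    conv_rhs => rw [← hlen]
    rw [N₂.pos_len hadj]
  · have h1 : (j * c + r) % c = r := by
      rw [Nat.add_comm, Nat.add_mul_mod_self_right, Nat.mod_eq_of_lt hr]
    have h2 : (j * c + r) / c = j := by
      rw [Nat.add_comm, Nat.add_mul_div_right _ _ hc, Nat.div_eq_of_lt hr, Nat.zero_add]
    rw [compPos, h1, h2, if_neg (by omega)]

theorem exists_mul_add {L c t : ℕ} (hL : 0 < L) (ht : t ≤ L * c) :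
    ∃ j r, j < L ∧ r ≤ c ∧ t = j * c + r := by
  rcases ht.eq_or_lt with rfl | ht
  · refine ⟨L - 1, c, by omega, le_rfl, ?_⟩
    obtain ⟨L, rfl⟩ : ∃ k, L = k + 1 := ⟨L - 1, by omega⟩
    simp; ring
  · have hc : 0 < c := Nat.pos_of_ne_zero (by rintro rfl; omega)
    exact ⟨t / c, t % c, (Nat.div_lt_iff_lt_mul hc).2 ht, (Nat.mod_lt _ hc).le,
      (Nat.div_add_mod' t c).symm⟩

theorem exists_mul_add_lt {L c t : ℕ} (ht : t < L * c) :
    ∃ j r, j < L ∧ r < c ∧ t = j * c + r := by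
  have hc : 0 < c := Nat.pos_of_ne_zero (by rintro rfl; omega)
  exact ⟨t / c, t % c, (Nat.div_lt_iff_lt_mul hc).2 ht, Nat.mod_lt _ hc,
    (Nat.div_add_mod' t c).symm⟩

end Compose

/-! ### Subdivisions of subdivisions -/

section Compose

variable {V : Type u} {W : Type v} {M : Type w} {G : SimpleGraph V} {H : SimpleGraph W}
  {K : SimpleGraph M} {N₁ : Net G H} {N₂ : Net H K} {c : V → V → ℕ}

variable (N₁ N₂) in
/-- Coordinates over `G` of a subdivision of a subdivision of `G`, if each edge of the path `ab` of
the first subdivision is replaced by a path of length `c a b`. -/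
noncomputable def Net.comp (hs : ∀ a b, c a b = c b a)
    (hc : ∀ {a b j}, G.Adj a b → j < N₁.len a b →
      N₂.len (N₁.pos a b j) (N₁.pos a b (j + 1)) = c a b) : Net G K where
  br a := N₂.br (N₁.br a)
  len a b := N₁.len a b * c a b
  pos a b t := compPos N₁ N₂ a b (c a b) t
  br_inj := N₂.br_inj.comp N₁.br_inj
  len_pos h := Nat.mul_pos (N₁.len_pos h)
    (hc h (N₁.len_pos h) ▸ N₂.len_pos (N₁.adj h (N₁.len_pos h)))
  len_symm a b := by rw [N₁.len_symm, hs]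
  pos_zero {a b} h := by
    simp [compPos, N₁.pos_zero h]
  pos_symm {a b t} h ht := by
    obtain ⟨j, r, hj, hr, rfl⟩ := exists_mul_add (N₁.len_pos h) ht
    have hL := N₁.len_symm a b
    have e : N₁.len a b * c a b - (j * c a b + r) =
        (N₁.len a b - (j + 1)) * c b a + (c b a - r) := by
      obtain ⟨k, hk⟩ : ∃ k, N₁.len a b = j + 1 + k := ⟨N₁.len a b - (j + 1), by omega⟩
      rw [hk, hs b a, Nat.add_sub_cancel_left]
      have : (j + 1 + k) * c a b = j * c a b + c a b + k * c a b := by ring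
      omega
    have e1 : N₁.pos b a (N₁.len a b - (j + 1)) = N₁.pos a b (j + 1) := N₁.pos_symm h hj
    have e2 : N₁.pos b a (N₁.len a b - (j + 1) + 1) = N₁.pos a b j := by
      rw [show N₁.len a b - (j + 1) + 1 = N₁.len a b - j by omega]
      exact N₁.pos_symm h hj.le
    rw [e, compPos_mul_add h.symm (by omega) (hc h.symm (by omega)) (by omega),
      compPos_mul_add h hj (hc h hj) hr, e1, e2, hs b a, ← hc h hj]
    exact N₂.pos_symm (N₁.adj h hj) (by rw [hc h hj]; exact hr)
  adj {a b t} h ht := by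
    obtain ⟨j, r, hj, hr, rfl⟩ := exists_mul_add_lt ht
    rw [Nat.add_assoc, compPos_mul_add h hj (hc h hj) hr.le, compPos_mul_add h hj (hc h hj) hr]
    exact N₂.adj (N₁.adj h hj) (by rw [hc h hj]; exact hr)
  br_ne {a b t} v h h0 ht he := by
    obtain ⟨j, r, hj, hr, rfl⟩ := exists_mul_add_lt ht
    rw [compPos_mul_add h hj (hc h hj) hr.le] at he
    rcases Nat.eq_zero_or_pos r with rfl | hr0
    · rw [N₂.pos_zero (N₁.adj h hj)] at he
      have hj0 : 0 < j := Nat.pos_of_ne_zero (by rintro rfl; simp at h0)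
      exact N₁.br_ne v h hj0 hj (N₂.br_inj he)
    · exact N₂.br_ne _ (N₁.adj h hj) hr0 (by rw [hc h hj]; exact hr) he
  inj {a b a' b' t s} h h' h0 ht hs' he := by
    obtain ⟨j, r, hj, hr, rfl⟩ := exists_mul_add_lt ht
    obtain ⟨i, q, hi, hq, rfl⟩ := exists_mul_add (N₁.len_pos h') hs'
    rw [compPos_mul_add h hj (hc h hj) hr.le, compPos_mul_add h' hi (hc h' hi) hq] at he
    have hlen := hc h hj
    have hlen' := hc h' hi
    rcases Nat.eq_zero_or_pos r with rfl | hr0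
    · have hj0 : 0 < j := Nat.pos_of_ne_zero (by rintro rfl; simp at h0)
      rw [N₂.pos_zero (N₁.adj h hj)] at he
      obtain ⟨i', hi', hq', he'⟩ : ∃ i', i' ≤ N₁.len a' b' ∧
          i * c a' b' + q = i' * c a' b' ∧ N₁.pos a b j = N₁.pos a' b' i' := by
        rcases N₂.eq_br (N₁.adj h' hi) (by rw [hlen']; exact hq) he.symm with h2 | h2
        · exact ⟨i, hi.le, by rw [h2.1]; rfl, h2.2⟩
        · exact ⟨i + 1, hi, by rw [h2.1, hlen']; ring, h2.2⟩
      rw [hq']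
      rcases N₁.inj h h' hj0 hj hi' he' with ⟨rfl, rfl, rfl⟩ | ⟨rfl, rfl, h3⟩
      · exact Or.inl ⟨rfl, rfl, rfl⟩
      · refine Or.inr ⟨rfl, rfl, ?_⟩
        rw [← h3, hs a' b']; ring
    · have hlt : r < N₂.len (N₁.pos a b j) (N₁.pos a b (j + 1)) := by rw [hlen]; exact hr
      rcases N₂.inj (N₁.adj h hj) (N₁.adj h' hi) hr0 hlt (by rw [hlen']; exact hq) he with
        ⟨h1, h2, rfl⟩ | ⟨h1, h2, h3⟩
      · obtain ⟨rfl, rfl, rfl⟩ := N₁.inj_succ h h' hj hi h1.symm h2.symm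
        exact Or.inl ⟨rfl, rfl, rfl⟩
      · have hL := N₁.len_symm a b
        have e1 : N₁.pos b a (N₁.len a b - (j + 1)) = N₁.pos a b (j + 1) := N₁.pos_symm h hj
        have e2 : N₁.pos b a (N₁.len a b - (j + 1) + 1) = N₁.pos a b j := by
          rw [show N₁.len a b - (j + 1) + 1 = N₁.len a b - j by omega]
          exact N₁.pos_symm h hj.le
        obtain ⟨rfl, rfl, rfl⟩ := N₁.inj_succ h.symm h' (by omega) hi
          (e1.trans h1.symm) (e2.trans h2.symm)
        refine Or.inr ⟨rfl, rfl, ?_⟩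
        rw [hlen] at h3
        obtain ⟨k, hk⟩ : ∃ k, N₁.len b' a' = j + 1 + k := ⟨N₁.len b' a' - (j + 1), by omega⟩
        rw [hk, hs a' b', Nat.add_sub_cancel_left]
        have : (j + 1 + k) * c b' a' = j * c b' a' + c b' a' + k * c b' a' := by ring
        omega

theorem Net.comp_covers (hs : ∀ a b, c a b = c b a)
    (hc : ∀ {a b j}, G.Adj a b → j < N₁.len a b →
      N₂.len (N₁.pos a b j) (N₁.pos a b (j + 1)) = c a b) (h₁ : N₁.Covers) (h₂ : N₂.Covers) :
    (N₁.comp N₂ hs hc).Covers where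
  vertex x := by
    rcases h₂.vertex x with ⟨y, rfl⟩ | ⟨y, z, r, hyz, hr0, hr, rfl⟩
    · rcases h₁.vertex y with ⟨a, rfl⟩ | ⟨a, b, j, h, hj0, hj, rfl⟩
      · exact Or.inl ⟨a, rfl⟩
      · have hcpos : 0 < c a b := hc h hj ▸ N₂.len_pos (N₁.adj h hj)
        exact Or.inr ⟨a, b, j * c a b, h, Nat.mul_pos hj0 hcpos,
          Nat.mul_lt_mul_of_pos_right hj hcpos,
          (compPos_mul a b hcpos j).symm⟩
    · obtain ⟨a, b, j, h, hj, rfl, rfl⟩ := h₁.edge hyz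
      rw [hc h hj] at hr
      refine Or.inr ⟨a, b, j * c a b + r, h, by omega, ?_,
        (compPos_mul_add h hj (hc h hj) hr.le).symm⟩
      have : (j + 1) * c a b ≤ N₁.len a b * c a b := Nat.mul_le_mul_right _ hj
      change _ < N₁.len a b * c a b
      linarith [Nat.succ_mul j (c a b)]
  edge {x y} hxy := by
    obtain ⟨y, z, r, hyz, hr, rfl, rfl⟩ := h₂.edge hxy
    obtain ⟨a, b, j, h, hj, rfl, rfl⟩ := h₁.edge hyz
    rw [hc h hj] at hr
    refine ⟨a, b, j * c a b + r, h, ?_, (compPos_mul_add h hj (hc h hj) hr.le).symm,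
      (compPos_mul_add h hj (hc h hj) hr).symm⟩
    have : (j + 1) * c a b ≤ N₁.len a b * c a b := Nat.mul_le_mul_right _ hj
    change _ < N₁.len a b * c a b
    linarith [Nat.succ_mul j (c a b)]

end Compose

section Refine

variable {V W : Type u} {G : SimpleGraph V} {H : SimpleGraph W}

/-- A finite subdivision of `G` can be subdivided further so that the lengths of the paths that
replace the edges of `G` are multiplied by prescribed factors. -/
theorem Net.exists_refinement [Finite W] (N : Net G H) (hN : N.Covers) (c : V → V → ℕ)
    (hs : ∀ a b, c a b = c b a) (hpos : ∀ a b, 0 < c a b) :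
    ∃ (W' : Type u) (_ : Finite W') (H' : SimpleGraph W') (N' : Net G H'),
      IsSubdivision H' H ∧ N'.Covers ∧ ∀ a b, N'.len a b = N.len a b * c a b := by
  classical
  let _ : LinearOrder W := LinearOrder.lift' (Finite.equivFin W) (Finite.equivFin W).injective
  let P : W → W → ℕ → Prop := fun x y m =>
    ∃ a b j, G.Adj a b ∧ j < N.len a b ∧ x = N.pos a b j ∧ y = N.pos a b (j + 1) ∧ m = c a b
  have hP : ∀ x y, H.Adj x y → ∃ m, P x y m := fun x y h => by
    obtain ⟨a, b, j, h1, h2, h3, h4⟩ := hN.edge h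
    exact ⟨_, a, b, j, h1, h2, h3, h4, rfl⟩
  have hPuniq : ∀ x y m m', P x y m → P x y m' → m = m' := by
    rintro x y m m' ⟨a, b, j, h1, h2, h3, h4, rfl⟩ ⟨a', b', j', h1', h2', h3', h4', rfl⟩
    obtain ⟨rfl, rfl, -⟩ := N.inj_succ h1 h1' h2 h2' (h3.symm.trans h3') (h4.symm.trans h4')
    rfl
  have hPsymm : ∀ x y m, P x y m → P y x m := by
    rintro x y m ⟨a, b, j, h1, h2, rfl, rfl, rfl⟩
    have hL := N.len_symm a b
    refine ⟨b, a, N.len a b - (j + 1), h1.symm, by omega, (N.pos_symm h1 h2).symm, ?_, hs a b⟩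
    rw [show N.len a b - (j + 1) + 1 = N.len a b - j by omega]
    exact (N.pos_symm h1 h2.le).symm
  let l : W → W → ℕ := fun x y => if h : ∃ m, P x y m then h.choose else 0
  have hl : ∀ x y m, P x y m → l x y = m := by
    intro x y m hm
    have hex : ∃ m, P x y m := ⟨m, hm⟩
    simp only [l, hex, dite_true]
    exact hPuniq _ _ _ _ hex.choose_spec hm
  have hlsymm : ∀ x y, l x y = l y x := by
    intro x y
    by_cases h : ∃ m, P x y m
    · obtain ⟨m, hm⟩ := h
      rw [hl _ _ _ hm, hl _ _ _ (hPsymm _ _ _ hm)]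
    · have h' : ¬ ∃ m, P y x m := fun ⟨m, hm⟩ => h ⟨m, hPsymm _ _ _ hm⟩
      simp only [l, h, h', dite_false]
  have hlpos : ∀ {x y}, H.Adj x y → 0 < l x y := by
    intro x y h
    obtain ⟨m, hm⟩ := hP x y h
    rw [hl _ _ _ hm]
    obtain ⟨a, b, j, -, -, -, -, rfl⟩ := hm
    exact hpos a b
  have hc : ∀ {a b j}, G.Adj a b → j < N.len a b →
      (modelNet hlsymm hlpos).len (N.pos a b j) (N.pos a b (j + 1)) = c a b :=
    fun {a b j} h hj => hl _ _ _ ⟨a, b, j, h, hj, rfl, rfl, rfl⟩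
  exact ⟨_, inferInstance, model H l hlsymm hlpos, N.comp (modelNet hlsymm hlpos) hs hc,
    (modelNet hlsymm hlpos).isSubdivision (modelNet_covers hlsymm hlpos),
    Net.comp_covers hs hc hN (modelNet_covers hlsymm hlpos), fun _ _ => rfl⟩

end Refine

/-! ### Sweeping with guards -/

section Forces

variable {W : Type v} {H : SimpleGraph W}

/-- With at most `k` inspections in each of the rounds `θ, …, θ' - 1` the searcher can force an
intruder who is in `P` at time `θ` and evades the inspections to be in `P'` at time `θ'`. -/
def Forces (H : SimpleGraph W) (k θ θ' : ℕ) (P P' : Set W) : Prop :=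
  θ ≤ θ' ∧ ∃ S : ℕ → Finset W, (∀ t, (S t).card ≤ k) ∧ ∀ x, IsTrajectory H x → x θ ∈ P →
    (∀ t, θ ≤ t → t < θ' → x t ∉ S t) → x θ' ∈ P'

theorem Forces.of_subset {k θ : ℕ} {P P' : Set W} (h : P ⊆ P') : Forces H k θ θ P P' :=
  ⟨le_rfl, fun _ => ∅, by simp, fun _ _ hx _ => h hx⟩

theorem Forces.trans {k θ₁ θ₂ θ₃ : ℕ} {P₁ P₂ P₃ : Set W} (h : Forces H k θ₁ θ₂ P₁ P₂)
    (h' : Forces H k θ₂ θ₃ P₂ P₃) : Forces H k θ₁ θ₃ P₁ P₃ := by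
  obtain ⟨h1, S, hS, hx⟩ := h
  obtain ⟨h1', S', hS', hx'⟩ := h'
  refine ⟨h1.trans h1', fun t => if t < θ₂ then S t else S' t, fun t => ?_, fun x hxt hP hav => ?_⟩
  · by_cases h : t < θ₂ <;> simp [h, hS, hS']
  · refine hx' x hxt (hx x hxt hP fun t h2 h3 => ?_) fun t h2 h3 => ?_
    · simpa [h3] using hav t h2 (by omega)
    · simpa [show ¬ t < θ₂ by omega] using hav t (by omega) h3

theorem Forces.of_step {k θ : ℕ} {P P' : Set W} (S : Finset W) (hS : S.card ≤ k)
    (h : ∀ x ∈ P, x ∉ S → ∀ y, (y = x ∨ H.Adj x y) → y ∈ P') : Forces H k θ (θ + 1) P P' :=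
  ⟨by omega, fun _ => S, fun _ => hS, fun x hx hP hav =>
    h _ hP (hav θ le_rfl (by omega)) _ (hx θ)⟩

theorem Forces.mono_left {k θ θ' : ℕ} {P Q P' : Set W} (h : Forces H k θ θ' P P') (hQ : Q ⊆ P) :
    Forces H k θ θ' Q P' := (Forces.of_subset hQ).trans h

theorem Forces.mono_right {k θ θ' : ℕ} {P P' Q : Set W} (h : Forces H k θ θ' P P') (hQ : P' ⊆ Q) :
    Forces H k θ θ' P Q := h.trans (Forces.of_subset hQ)

theorem Forces.searcherWins {k θ : ℕ} {P : Set W} (h : Forces H k 0 θ P ∅) (hP : ∀ x, x ∈ P) :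
    SearcherWins H k := by
  obtain ⟨_, S, hS, hx⟩ := h
  refine ⟨θ, fun t => S t, fun t => hS t, fun x hxt => ?_⟩
  by_contra hcon
  push Not at hcon
  exact hx x hxt (hP _) fun t _ ht => hcon ⟨t, ht⟩

end Forces

section Dirty

variable {V : Type u} {W : Type v} {H : SimpleGraph W}

/-- The possible positions of the intruder at time `θ`: the branch vertices of `F`, and on the
paths of the pairs in `E` those interior vertices that are not protected by a deadline. The
deadline `d u v` says that dirt on the path `uv` needs until time `d u v` to reach `u`, so
at time `θ` the vertices at distance less than `d u v - θ` from `u` are clean. -/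
def Net.Dirty (N : Net (⊤ : SimpleGraph V) H) (θ : ℕ) (F : Set V) (E : V → V → Prop)
    (d : V → V → ℕ) : Set W :=
  {x | (∃ v ∈ F, x = N.br v) ∨ ∃ u v t, u ≠ v ∧ 0 < t ∧ t < N.len u v ∧ x = N.pos u v t ∧
    E u v ∧ d u v ≤ t + θ ∧ d v u ≤ N.len u v - t + θ}

variable {N : Net (⊤ : SimpleGraph V) H} {θ : ℕ} {E : V → V → Prop} {d : V → V → ℕ}

theorem Net.dirty_mono {F F' : Set V} {E' : V → V → Prop} {d' : V → V → ℕ} (hF : F ⊆ F')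
    (hE : ∀ u v t, u ≠ v → 0 < t → t < N.len u v → E u v → d u v ≤ t + θ →
      d v u ≤ N.len u v - t + θ →
      E' u v)
    (hd : ∀ u v, E' u v → d' u v ≤ d u v ∨ d' u v ≤ θ + 1) (hE' : ∀ u v, E' u v → E' v u) :
    N.Dirty θ F E d ⊆ N.Dirty θ F' E' d' := by
  rintro x (⟨v, hv, rfl⟩ | ⟨u, v, t, huv, ht0, ht, rfl, h1, h2, h3⟩)
  · exact Or.inl ⟨v, hF hv, rfl⟩
  · have he := hE u v t huv ht0 ht h1 h2 h3
    refine Or.inr ⟨u, v, t, huv, ht0, ht, rfl, he, ?_, ?_⟩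
    · rcases hd u v he with h | h <;> omega
    · rcases hd v u (hE' _ _ he) with h | h <;> omega

/-- One move of the intruder, from a position that has survived the inspection of that round. A
vertex `v` outside `F'` stays clean because no deadline at `v` expires. -/
theorem Net.dirty_move (hN : N.Covers) (hlen : ∀ u v, u ≠ v → 2 ≤ N.len u v)
    (hEs : ∀ u v, E u v → E v u) {U F' : Set V}
    (hU0 : ∀ v ∈ U, ∀ u, d v u = 0) (hUlen : ∀ v ∈ U, ∀ u, u ≠ v → d u v ≤ N.len u v + θ)
    (hUE : ∀ v ∈ U, ∀ u, u ≠ v → E v u) (hUF : U ⊆ F')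
    (hF : ∀ v u, v ≠ u → E v u → v ∉ F' → θ + 1 < d v u)
    {x y : W} (hx : x ∈ N.Dirty θ U E d) (hxy : y = x ∨ H.Adj x y) :
    y ∈ N.Dirty (θ + 1) F' E d := by
  rcases hxy with rfl | hxy
  · rcases hx with ⟨v, hv, rfl⟩ | ⟨u, v, t, huv, ht0, ht, rfl, h1, h2, h3⟩
    · exact Or.inl ⟨v, hUF hv, rfl⟩
    · exact Or.inr ⟨u, v, t, huv, ht0, ht, rfl, h1, by omega, by omega⟩
  obtain ⟨a, b, s, hab, hs, rfl, rfl⟩ := hN.edge hxy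
  replace hab : a ≠ b := hab
  have hl := hlen a b hab
  have hls := N.len_symm a b
  -- either the move starts at the end vertex `a` of the path, or inside the path
  have hcase : (s = 0 ∧ a ∈ U) ∨ (0 < s ∧ E a b ∧ d a b ≤ s + θ ∧ d b a ≤ N.len a b - s + θ) := by
    rcases hx with ⟨v, hv, he⟩ | ⟨u, v, t, huv, ht0, ht, he, h1, h2, h3⟩
    · rcases N.eq_br hab hs.le he with ⟨rfl, rfl⟩ | ⟨rfl, rfl⟩
      · exact Or.inl ⟨rfl, hv⟩
      · omega
    · have hls' := N.len_symm u v
      rcases N.inj huv hab ht0 ht hs.le he.symm with ⟨rfl, rfl, rfl⟩ | ⟨rfl, rfl, h⟩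
      · exact Or.inr ⟨ht0, h1, h2, h3⟩
      · exact Or.inr ⟨by omega, hEs _ _ h1, by omega, by omega⟩
  rcases hcase with ⟨rfl, ha⟩ | ⟨hs0, h1, h2, h3⟩
  · refine Or.inr ⟨a, b, 1, hab, by omega, by omega, rfl, hUE a ha b hab.symm, ?_, ?_⟩
    · rw [hU0 a ha b]; omega
    · have := hUlen a ha b hab.symm
      omega
  · rcases (show s + 1 ≤ N.len a b from hs).lt_or_eq with hlt | heq
    · exact Or.inr ⟨a, b, s + 1, hab, by omega, hlt, rfl, h1, by omega, by omega⟩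
    · refine Or.inl ⟨b, ?_, by rw [heq, N.pos_len hab]⟩
      by_contra hb
      have := hF b a hab.symm (hEs _ _ h1) hb
      omega

/-- The deadlines `d` with the value at the oriented pair `ab` replaced by `m`. -/
def setDeadline [DecidableEq V] (d : V → V → ℕ) (a b : V) (m : ℕ) : V → V → ℕ :=
  fun u v => if u = a ∧ v = b then m else d u v

section Update

variable [DecidableEq V]

theorem setDeadline_self (d : V → V → ℕ) (a b : V) (m : ℕ) : setDeadline d a b m a b = m := by
  simp [setDeadline]

theorem setDeadline_of_ne {d : V → V → ℕ} {a b u v : V} {m : ℕ} (h : ¬ (u = a ∧ v = b)) :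
    setDeadline d a b m u v = d u v := by
  simp [setDeadline, h]

/-- While the branch vertices of `Q` are guarded, two further inspections per round push the end of
the clean initial segment of the path `ab` by `T` vertices in `T` rounds. -/
theorem Net.forces_sweep [DecidableEq W] (hN : N.Covers) (hlen : ∀ u v, u ≠ v → 2 ≤ N.len u v)
    (hEs : ∀ u v, E u v → E v u) {U : Set V} {Q : Finset V} {k : ℕ} (hk : Q.card + 2 ≤ k)
    (hU0 : ∀ v ∈ U, ∀ u, d v u = 0) (hUlen : ∀ v ∈ U, ∀ u, u ≠ v → d u v ≤ N.len u v + θ)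
    (hUE : ∀ v ∈ U, ∀ u, u ≠ v → E v u) {a b : V} (hab : a ≠ b) (ha : a ∉ U) (p T : ℕ)
    (hb : b ∈ U → p + T + 1 ≤ N.len a b)
    (hZ : ∀ v u, v ≠ u → E v u → v ∉ U ∪ (Q : Set V) → ¬ (v = a ∧ u = b) → θ + T < d v u) :
    Forces H k θ (θ + T) (N.Dirty θ (U ∪ Q) E (setDeadline d a b (θ + p)))
      (N.Dirty (θ + T) (U ∪ Q) E (setDeadline d a b (θ + T + (p + T)))) := by
  induction T with
  | zero => exact Forces.of_subset (by simp)
  | succ T ih =>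
    refine (ih (fun h => by have := hb h; omega)
      (fun v u h1 h2 h3 h4 => by have := hZ v u h1 h2 h3 h4; omega)).trans ?_
    rw [← Nat.add_assoc]
    have hls := N.len_symm a b
    refine Forces.of_step (Q.image N.br ∪ {N.pos a b (p + T), N.pos a b (p + T + 1)}) ?_ ?_
    · refine (Finset.card_union_le _ _).trans ?_
      have h1 : (Q.image N.br).card ≤ Q.card := Finset.card_image_le
      have h2 := Finset.card_le_two (a := N.pos a b (p + T)) (b := N.pos a b (p + T + 1))
      omega
    · intro x hx hxS y hxy
      have hval : θ + T + 1 + (p + (T + 1)) = θ + T + (p + T) + 2 := by omega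
      rw [hval]
      simp only [Finset.mem_union, Finset.mem_image, Finset.mem_insert, Finset.mem_singleton,
        not_or, not_exists, not_and] at hxS
      -- the inspected positions are the first two of the dirty segment
      have hx' : x ∈ N.Dirty (θ + T) U E (setDeadline d a b (θ + T + (p + T) + 2)) := by
        rcases hx with ⟨v, hv, rfl⟩ | ⟨u, v, t, huv, ht0, ht, rfl, h1, h2, h3⟩
        · rcases hv with hv | hv
          · exact Or.inl ⟨v, hv, rfl⟩
          · exact absurd rfl (hxS.1 v hv)
        · refine Or.inr ⟨u, v, t, huv, ht0, ht, rfl, h1, ?_, ?_⟩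
          · by_cases h : u = a ∧ v = b
            · obtain ⟨rfl, rfl⟩ := h
              rw [setDeadline_self] at h2 ⊢
              have e1 : t ≠ p + T := fun h => hxS.2.1 (by rw [h])
              have e2 : t ≠ p + T + 1 := fun h => hxS.2.2 (by rw [h])
              omega
            · rw [setDeadline_of_ne h] at h2 ⊢; exact h2
          · by_cases h : v = a ∧ u = b
            · obtain ⟨rfl, rfl⟩ := h
              rw [setDeadline_self] at h3 ⊢
              rw [← N.pos_symm huv ht.le] at hxS
              have e1 : N.len u v - t ≠ p + T := fun h => hxS.2.1 (by rw [h])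
              have e2 : N.len u v - t ≠ p + T + 1 := fun h => hxS.2.2 (by rw [h])
              omega
            · rw [setDeadline_of_ne h] at h3 ⊢; exact h3
      refine N.dirty_move hN hlen hEs ?_ ?_ hUE Set.subset_union_left ?_ hx' hxy
      · intro v hv u
        rw [setDeadline_of_ne (by rintro ⟨rfl, -⟩; exact ha hv)]
        exact hU0 v hv u
      · intro v hv u huv
        by_cases h : u = a ∧ v = b
        · obtain ⟨rfl, rfl⟩ := h
          rw [setDeadline_self]
          have := hb hv
          omega
        · rw [setDeadline_of_ne h]
          have := hUlen v hv u huv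
          omega
      · intro v u hvu hE hv
        by_cases h : v = a ∧ u = b
        · obtain ⟨rfl, rfl⟩ := h
          rw [setDeadline_self]; omega
        · rw [setDeadline_of_ne h]
          have := hZ v u hvu hE hv h
          omega

end Update

/-- One round of guarding `Q`, after which the guards are no longer needed, because no deadline
at a vertex of `Q` expires. -/
theorem Net.forces_release [DecidableEq W] (hN : N.Covers) (hlen : ∀ u v, u ≠ v → 2 ≤ N.len u v)
    (hEs : ∀ u v, E u v → E v u) {U : Set V} {Q : Finset V} {k : ℕ} (hk : Q.card ≤ k)
    (hU0 : ∀ v ∈ U, ∀ u, d v u = 0) (hUlen : ∀ v ∈ U, ∀ u, u ≠ v → d u v ≤ N.len u v + θ)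
    (hUE : ∀ v ∈ U, ∀ u, u ≠ v → E v u)
    (hF : ∀ v u, v ≠ u → E v u → v ∉ U → θ + 1 < d v u) :
    Forces H k θ (θ + 1) (N.Dirty θ (U ∪ Q) E d) (N.Dirty (θ + 1) U E d) := by
  refine Forces.of_step (Q.image N.br) (Finset.card_image_le.trans hk) ?_
  intro x hx hxS y hxy
  refine N.dirty_move hN hlen hEs hU0 hUlen hUE le_rfl hF ?_ hxy
  rcases hx with ⟨v, hv | hv, rfl⟩ | h
  · exact Or.inl ⟨v, hv, rfl⟩
  · exact absurd (Finset.mem_image_of_mem _ hv) hxS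
  · exact Or.inr h

end Dirty

/-! ### One guarded group -/

theorem union_group {V : Type u} [Fintype V] (grp : V → ℕ) (p : ℕ) :
    {v | p < grp v} ∪ ((Finset.univ.filter fun v => grp v = p : Finset V) : Set V) =
      {v | p ≤ grp v} := by
  ext v
  simp [le_iff_lt_or_eq, eq_comm]

section Phase

variable {V : Type u} {W : Type v} [LinearOrder V] [Fintype V]

open Classical in
/-- The total length of the paths of the family `F` whose rank is less than `i`. -/
noncomputable def lowerSum (l rk : V → V → ℕ) (F : V → V → Prop) (i : ℕ) : ℕ :=
  ∑ p ∈ Finset.univ.filter (fun p : V × V => p.1 < p.2 ∧ F p.1 p.2 ∧ rk p.1 p.2 < i), l p.1 p.2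

variable {l rk : V → V → ℕ}

theorem lowerSum_mono {F F' : V → V → Prop} {i j : ℕ}
    (hF : ∀ a b, a < b → F a b → rk a b < i → F' a b ∧ rk a b < j) :
    lowerSum l rk F i ≤ lowerSum l rk F' j := by
  classical
  refine Finset.sum_le_sum_of_subset fun p hp => ?_
  simp only [Finset.mem_filter, Finset.mem_univ, true_and] at hp ⊢
  exact ⟨hp.1, hF _ _ hp.1 hp.2.1 hp.2.2⟩

theorem lowerSum_mono_right {F : V → V → Prop} {i j : ℕ} (h : i ≤ j) :
    lowerSum l rk F i ≤ lowerSum l rk F j :=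
  lowerSum_mono fun _ _ _ hF hi => ⟨hF, hi.trans_le h⟩

theorem lowerSum_add_le {F : V → V → Prop} {a b : V} (hab : a < b) (hF : F a b) :
    lowerSum l rk F (rk a b) + l a b ≤ lowerSum l rk F (rk a b + 1) := by
  classical
  have hnot : (a, b) ∉ Finset.univ.filter
      (fun p : V × V => p.1 < p.2 ∧ F p.1 p.2 ∧ rk p.1 p.2 < rk a b) := by simp
  have h := Finset.sum_insert (f := fun p : V × V => l p.1 p.2) hnot
  simp only [lowerSum]
  rw [Nat.add_comm, ← h]
  refine Finset.sum_le_sum_of_subset fun p hp => ?_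
  simp only [Finset.mem_insert, Finset.mem_filter, Finset.mem_univ, true_and] at hp ⊢
  rcases hp with rfl | hp
  · exact ⟨hab, hF, by simp⟩
  · exact ⟨hp.1, hp.2.1, by omega⟩

variable {H : SimpleGraph W} {N : Net (⊤ : SimpleGraph V) H} {grp : V → ℕ} {θ p k R : ℕ}
  {d : V → V → ℕ}

/-- The pairs that are dirty while the vertices of group `p` are guarded and the paths of rank less
than `i` that join group `p` to itself or to smaller groups have been cleaned. -/
def Open (grp : V → ℕ) (rk : V → V → ℕ) (p i : ℕ) (u v : V) : Prop :=
  p < max (grp u) (grp v) ∨ (max (grp u) (grp v) = p ∧ i ≤ rk u v)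

/-- The paths cleaned completely while group `p` is guarded. -/
def Closing (grp : V → ℕ) (p : ℕ) (u v : V) : Prop := max (grp u) (grp v) = p

/-- The paths cleaned up to their last vertex while group `p` is guarded. -/
def Outgoing (grp : V → ℕ) (p : ℕ) (u v : V) : Prop := grp u = p ∧ p < grp v

variable (N grp p) in
/-- The assumptions under which group `p` is guarded with `k` inspections per round: the groups
follow the order of the vertices, distinct pairs have distinct ranks below `R`, and two inspections
per round are left over. -/
structure Setting (rk : V → V → ℕ) (k R : ℕ) : Prop where
  covers : N.Covers
  two_le : ∀ u v, u ≠ v → 2 ≤ N.len u v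
  mono : Monotone grp
  rk_symm : ∀ u v, rk u v = rk v u
  rk_inj : ∀ a b a' b', a < b → a' < b' → rk a b = rk a' b' → a = a' ∧ b = b'
  rk_lt : ∀ u v, rk u v < R
  card_le : (Finset.univ.filter fun v => grp v = p).card + 2 ≤ k

/-- While group `p` is guarded, all paths from smaller groups and within the group can be cleaned,
in increasing order of rank, if the deadlines of the smaller groups are long enough. -/
theorem Setting.forces_close (h : Setting N grp p rk k R)
    (hU0 : ∀ v, p < grp v → ∀ u, d v u = 0)
    (hlen : ∀ u v, u ≠ v → d u v ≤ N.len u v + θ)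
    (hZ : ∀ a b, grp a < p → grp b = p → θ + lowerSum N.len rk (Closing grp p) (rk a b) < d a b)
    (hZ' : ∀ a b, grp a < p → p < grp b → θ + lowerSum N.len rk (Closing grp p) R < d a b)
    (i : ℕ) (hi : i ≤ R) :
    ∃ θ' ≤ θ + lowerSum N.len rk (Closing grp p) i,
      Forces H k θ θ' (N.Dirty θ {v | p ≤ grp v} (Open grp rk p 0) d)
        (N.Dirty θ' {v | p ≤ grp v} (Open grp rk p i) d) := by
  classical
  induction i with
  | zero => exact ⟨θ, by omega, Forces.of_subset le_rfl⟩
  | succ i ih =>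
    obtain ⟨θ', hθ', hf⟩ := ih (by omega)
    have hEs : ∀ i u v, Open grp rk p i u v → Open grp rk p i v u := by
      intro i u v; simp only [Open, max_comm, h.rk_symm u v]; exact id
    by_cases hex : ∃ a b, a < b ∧ Closing grp p a b ∧ rk a b = i
    · obtain ⟨a, b, hab, hcl, rfl⟩ := hex
      have hgab : grp a ≤ grp b := h.mono hab.le
      have hgb : grp b = p := by rw [← hcl, max_eq_right hgab]
      -- the clean initial segment of the path at time `θ'`
      set q := min (d a b - θ') (N.len a b) with hq
      set T := N.len a b - q with hT
      have hsum := lowerSum_add_le (l := N.len) (rk := rk) hab hcl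
      refine ⟨θ' + T, by omega, hf.trans ?_⟩
      have hsweep := N.forces_sweep (θ := θ') (E := Open grp rk p (rk a b)) (d := d) h.covers
        h.two_le (hEs _) (U := {v | p < grp v}) (Q := Finset.univ.filter fun v => grp v = p)
        h.card_le (fun v hv => hU0 v hv)
        (fun v _ u huv => (hlen u v huv).trans (by have := hf.1; omega))
        (fun v hv u _ => Or.inl (lt_max_of_lt_left hv)) hab.ne
        (a := a) (b := b) (by simp only [Set.mem_ofPred_eq]; omega) q T
        (fun hb => absurd hb (by simp only [Set.mem_ofPred_eq]; omega)) (by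
          intro v u hvu hE hv hne
          rw [union_group] at hv
          replace hv : grp v < p := by simpa using hv
          rcases hE with hE | ⟨hE, hr⟩
          · have hu : p < grp u := by
              rcases lt_max_iff.1 hE with h1 | h1
              · omega
              · exact h1
            have h1 := hZ' v u hv hu
            have h2 : lowerSum N.len rk (Closing grp p) (rk a b + 1) ≤
              lowerSum N.len rk (Closing grp p) R := lowerSum_mono_right hi
            omega
          · have hu : grp u = p := by
              rcases max_choice (grp v) (grp u) with h1 | h1 <;> omega
            have hlt : v < u := lt_of_not_ge fun hle => by have := h.mono hle; omega
            have hrne : rk a b ≠ rk v u := fun hr' => by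
              obtain ⟨rfl, rfl⟩ := h.rk_inj _ _ _ _ hab hlt hr'
              exact hne ⟨rfl, rfl⟩
            have h1 := hZ v u hv hu
            have h2 : lowerSum N.len rk (Closing grp p) (rk a b + 1) ≤
              lowerSum N.len rk (Closing grp p) (rk v u) := lowerSum_mono_right (by omega)
            omega)
      rw [union_group] at hsweep
      refine (hsweep.mono_left ?_).mono_right ?_
      · refine N.dirty_mono le_rfl (fun _ _ _ _ _ _ h _ _ => h) (fun u v _ => ?_) (hEs _)
        by_cases he : u = a ∧ v = b
        · obtain ⟨rfl, rfl⟩ := he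
          rw [setDeadline_self]; omega
        · rw [setDeadline_of_ne he]; exact Or.inl le_rfl
      · have hstill : ∀ u v, Open grp rk p (rk a b + 1) u v → ¬ (u = a ∧ v = b) := by
          rintro u v hE ⟨rfl, rfl⟩
          rcases hE with hE | hE
          · exact absurd hcl hE.ne'
          · omega
        refine N.dirty_mono le_rfl (fun u v t huv ht0 ht hE h1 h2 => ?_) (fun u v hE => ?_) (hEs _)
        · rcases hE with hE | ⟨hE, hr⟩
          · exact Or.inl hE
          · refine Or.inr ⟨hE, lt_of_le_of_ne hr fun hr' => ?_⟩
            have hls := N.len_symm u v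
            rcases huv.lt_or_gt with hlt | hlt
            · obtain ⟨rfl, rfl⟩ := h.rk_inj _ _ _ _ hab hlt hr'
              rw [setDeadline_self] at h1
              omega
            · rw [h.rk_symm u v] at hr'
              obtain ⟨rfl, rfl⟩ := h.rk_inj _ _ _ _ hab hlt hr'
              rw [setDeadline_self] at h2
              omega
        · rw [setDeadline_of_ne (hstill u v hE)]; exact Or.inl le_rfl
    · refine ⟨θ', hθ'.trans (Nat.add_le_add_left (lowerSum_mono_right (by omega)) _),
        hf.mono_right ?_⟩
      refine N.dirty_mono le_rfl (fun u v t huv ht0 ht hE h1 h2 => ?_)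
        (fun u v _ => Or.inl le_rfl) (hEs _)
      rcases hE with hE | ⟨hE, hr⟩
      · exact Or.inl hE
      · refine Or.inr ⟨hE, lt_of_le_of_ne hr fun hr' => ?_⟩
        rcases huv.lt_or_gt with hlt | hlt
        · exact hex ⟨u, v, hlt, hE, hr'.symm⟩
        · exact hex ⟨v, u, hlt, by rwa [Closing, max_comm], by rw [h.rk_symm, hr']⟩

/-- While group `p` is guarded, all paths to larger groups can be cleaned up to their last vertex,
in decreasing order of rank. -/
theorem Setting.forces_out (h : Setting N grp p rk k R)
    (hU0 : ∀ v, p < grp v → ∀ u, d v u = 0)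
    (hlen : ∀ u v, u ≠ v → d u v ≤ N.len u v + θ)
    (hZ : ∀ a b, grp a < p → p < grp b → θ + lowerSum N.len rk (Outgoing grp p) R < d a b)
    (j i : ℕ) (hi : i + j = R) :
    ∃ θ' d', θ' + lowerSum N.len rk (Outgoing grp p) i ≤ θ + lowerSum N.len rk (Outgoing grp p) R ∧
      Forces H k θ θ' (N.Dirty θ {v | p ≤ grp v} (Open grp rk p R) d)
        (N.Dirty θ' {v | p ≤ grp v} (Open grp rk p R) d') ∧
      (∀ u v, ¬ Outgoing grp p u v → d' u v = d u v) ∧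
      (∀ u v, u ≠ v → d' u v ≤ N.len u v + θ') ∧
      ∀ u v, Outgoing grp p u v → i ≤ rk u v →
        θ' + lowerSum N.len rk (Outgoing grp p) i + N.len u v ≤
          d' u v + lowerSum N.len rk (Outgoing grp p) (rk u v) + 1 := by
  classical
  induction j generalizing i with
  | zero =>
    obtain rfl : i = R := by omega
    refine ⟨θ, d, le_rfl, Forces.of_subset le_rfl, fun _ _ _ => rfl, hlen, fun u v _ hr => ?_⟩
    exact absurd (h.rk_lt u v) (by omega)
  | succ j ih =>
    obtain ⟨θ', d', hθ', hf, hd, hlen', hout⟩ := ih (i + 1) (by omega)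
    have hEs : ∀ u v, Open grp rk p R u v → Open grp rk p R v u := by
      intro u v; simp only [Open, max_comm, h.rk_symm u v]; exact id
    have hmono : lowerSum N.len rk (Outgoing grp p) i ≤
      lowerSum N.len rk (Outgoing grp p) (i + 1) := lowerSum_mono_right (by omega)
    by_cases hex : ∃ a b, a < b ∧ Outgoing grp p a b ∧ rk a b = i
    · obtain ⟨a, b, hab, hcl, rfl⟩ := hex
      have hsum := lowerSum_add_le (l := N.len) (rk := rk) hab hcl
      have h2 := h.two_le a b hab.ne
      set T := N.len a b - 2 with hT
      have hsweep := N.forces_sweep (θ := θ') (E := Open grp rk p R) (d := d') h.covers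
        h.two_le hEs (U := {v | p < grp v}) (Q := Finset.univ.filter fun v => grp v = p)
        h.card_le
        (fun v hv u => by
          rw [hd v u (fun ho => absurd hv (by simp only [Set.mem_ofPred_eq]; have := ho.1; omega))]
          exact hU0 v hv u)
        (fun v _ u huv => hlen' u v huv)
        (fun v hv u _ => Or.inl (lt_max_of_lt_left hv)) hab.ne
        (a := a) (b := b) (by simp only [Set.mem_ofPred_eq]; have := hcl.1; omega) 1 T
        (fun hb => by omega) (by
          intro v u hvu hE hv hne
          rw [union_group] at hv
          replace hv : grp v < p := by simpa using hv
          rcases hE with hE | ⟨hE, hr⟩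
          · have hu : p < grp u := by
              rcases lt_max_iff.1 hE with h1 | h1
              · omega
              · exact h1
            rw [hd v u (fun ho => by have := ho.1; omega)]
            have h1 := hZ v u hv hu
            omega
          · exact absurd (h.rk_lt v u) (by omega))
      rw [union_group] at hsweep
      refine ⟨θ' + T, setDeadline d' a b (θ' + T + (1 + T)), by omega,
        hf.trans (hsweep.mono_left ?_), ?_, ?_, ?_⟩
      · refine N.dirty_mono le_rfl (fun _ _ _ _ _ _ h _ _ => h) (fun u v _ => ?_) hEs
        by_cases he : u = a ∧ v = b
        · obtain ⟨rfl, rfl⟩ := he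
          rw [setDeadline_self]; exact Or.inr le_rfl
        · rw [setDeadline_of_ne he]; exact Or.inl le_rfl
      · intro u v ho
        rw [setDeadline_of_ne (by rintro ⟨rfl, rfl⟩; exact ho hcl), hd u v ho]
      · intro u v huv
        by_cases he : u = a ∧ v = b
        · obtain ⟨rfl, rfl⟩ := he
          rw [setDeadline_self]; omega
        · rw [setDeadline_of_ne he]
          have := hlen' u v huv
          omega
      · intro u v ho hr
        by_cases he : u = a ∧ v = b
        · obtain ⟨rfl, rfl⟩ := he
          rw [setDeadline_self]; omega
        · rw [setDeadline_of_ne he]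
          have hlt : u < v := lt_of_not_ge fun hle => by
            have := h.mono hle; have := ho.1; have := ho.2; omega
          have hne : rk a b ≠ rk u v := fun hr' => by
            obtain ⟨rfl, rfl⟩ := h.rk_inj _ _ _ _ hab hlt hr'
            exact he ⟨rfl, rfl⟩
          have := hout u v ho (by omega)
          omega
    · refine ⟨θ', d', by omega, hf, hd, hlen', fun u v ho hr => ?_⟩
      have hlt : u < v := lt_of_not_ge fun hle => by
        have := h.mono hle; have := ho.1; have := ho.2; omega
      have := hout u v ho (lt_of_le_of_ne hr fun hr' => hex ⟨u, v, hlt, ho, hr'.symm⟩)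
      omega

/-- Guarding group `p`, the searcher cleans all that lies between the groups up to `p`, and
cleans the paths from group `p` to the larger groups up to their last vertex. -/
theorem Setting.forces_phase (h : Setting N grp p rk k R)
    (hU0 : ∀ v, p ≤ grp v → ∀ u, d v u = 0)
    (hlen : ∀ u v, u ≠ v → d u v ≤ N.len u v + θ)
    (hsmall : ∀ a b, Outgoing grp p a b →
      lowerSum N.len rk (Outgoing grp p) (rk a b) + 3 ≤ N.len a b)
    (hZ : ∀ a b, grp a < p → grp b = p → θ + lowerSum N.len rk (Closing grp p) (rk a b) < d a b)
    (hZ' : ∀ a b, grp a < p → p < grp b → θ + lowerSum N.len rk (Closing grp p) R +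
      lowerSum N.len rk (Outgoing grp p) R + 1 < d a b) :
    ∃ θ' d', θ' ≤ θ + lowerSum N.len rk (Closing grp p) R +
        lowerSum N.len rk (Outgoing grp p) R + 1 ∧
      Forces H k θ θ' (N.Dirty θ {v | p ≤ grp v} (Open grp rk p 0) d)
        (N.Dirty θ' {v | p + 1 ≤ grp v} (Open grp rk (p + 1) 0) d') ∧
      (∀ u v, ¬ Outgoing grp p u v → d' u v = d u v) ∧
      (∀ u v, u ≠ v → d' u v ≤ N.len u v + θ') ∧
      ∀ u v, Outgoing grp p u v →
        θ' + N.len u v ≤ d' u v + lowerSum N.len rk (Outgoing grp p) (rk u v) + 2 := by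
  classical
  obtain ⟨θ₁, hθ₁, hf₁⟩ := h.forces_close (d := d) (θ := θ) (fun v hv => hU0 v hv.le) hlen hZ
    (fun a b ha hb => by have := hZ' a b ha hb; omega) R le_rfl
  have hle₁ := hf₁.1
  obtain ⟨θ₂, d', hθ₂, hf₂, hd, hlen', hout⟩ := h.forces_out (d := d) (θ := θ₁)
    (fun v hv => hU0 v hv.le) (fun u v huv => by have := hlen u v huv; omega)
    (fun a b ha hb => by have := hZ' a b ha hb; omega) R 0 (by omega)
  have hU0' : ∀ v, p < grp v → ∀ u, d' v u = 0 := fun v hv u => by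
    rw [hd v u (fun ho => by have := ho.1; omega)]; exact hU0 v hv.le u
  have hEs : ∀ u v, Open grp rk p R u v → Open grp rk p R v u := by
    intro u v; simp only [Open, max_comm, h.rk_symm u v]; exact id
  have hEs' : ∀ u v, Open grp rk (p + 1) 0 u v → Open grp rk (p + 1) 0 v u := by
    intro u v; simp only [Open, max_comm, h.rk_symm u v]; exact id
  have hf₃ := N.forces_release (θ := θ₂) (E := Open grp rk p R) (d := d') (k := k) h.covers
    h.two_le hEs (U := {v | p < grp v}) (Q := Finset.univ.filter fun v => grp v = p)
    (by have := h.card_le; omega) hU0' (fun v _ u huv => hlen' u v huv)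
    (fun v hv u _ => Or.inl (lt_max_of_lt_left hv)) (by
      intro v u hvu hE hv
      replace hv : grp v ≤ p := by simpa using hv
      rcases hE with hE | ⟨hE, hr⟩
      · have hu : p < grp u := by
          rcases lt_max_iff.1 hE with h1 | h1
          · omega
          · exact h1
        rcases hv.lt_or_eq with hv | hv
        · rw [hd v u (fun ho => by have := ho.1; omega)]
          have h1 := hZ' v u hv hu
          omega
        · have h1 := hout v u ⟨hv, hu⟩ (Nat.zero_le _)
          have h2 := hsmall v u ⟨hv, hu⟩
          omega
      · exact absurd (h.rk_lt v u) (by omega))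
  rw [union_group] at hf₃
  refine ⟨θ₂ + 1, d', by omega, (hf₁.trans (hf₂.trans hf₃)).mono_right ?_, hd, ?_, ?_⟩
  · refine N.dirty_mono le_rfl (fun u v t huv ht0 ht hE h1 h2 => ?_)
      (fun u v _ => Or.inl le_rfl) hEs'
    rcases hE with hE | ⟨hE, hr⟩
    · simp only [Open]; omega
    · exact absurd (h.rk_lt u v) (by omega)
  · intro u v huv
    have := hlen' u v huv
    omega
  · intro u v ho
    have := hout u v ho (Nat.zero_le _)
    omega

end Phase

/-! ### Complete graphs -/

theorem geom_identity (L r : ℕ) : 8 * L * ∑ j ∈ Finset.range r, (8 * L + 1) ^ j + 1 =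
    (8 * L + 1) ^ r := by
  induction r with
  | zero => simp
  | succ r ih =>
    rw [Finset.sum_range_succ, pow_succ, mul_add]
    linarith

section Upper

variable {V : Type u} {W : Type v} [LinearOrder V] [Fintype V]
  {H : SimpleGraph W} {N : Net (⊤ : SimpleGraph V) H} {grp : V → ℕ} {k R : ℕ} {rk : V → V → ℕ}

/-- If the vertices are split into three groups of at most `k - 2` vertices, every path is much
longer than all paths of smaller rank together, and the paths between the first and the last
group have the largest ranks, then `k` inspections per round suffice. -/
theorem searcherWins_of_groups (h : ∀ p, Setting N grp p rk k R) (hgrp : ∀ v, grp v < 3)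
    (hrank : ∀ a b a' b', grp a = 0 → grp b = 2 → a' < b' →
      (Closing grp 1 a' b' ∨ Outgoing grp 1 a' b') → rk a' b' < rk a b)
    (hlong : ∀ a b, a ≠ b →
      8 * lowerSum N.len rk (fun _ _ => True) (rk a b) + 8 ≤ N.len a b) :
    SearcherWins H k := by
  have hY : ∀ (F : V → V → Prop) i, lowerSum N.len rk F i ≤
      lowerSum N.len rk (fun _ _ => True) i := fun F i =>
    lowerSum_mono fun _ _ _ _ hr => ⟨trivial, hr⟩
  have hne : ∀ {a b}, grp a ≠ grp b → a ≠ b := fun hab h => hab (by rw [h])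
  -- the first group, all deadlines are zero at the start
  obtain ⟨θ₁, d₁, -, hf₁, hd₁, hlen₁, hout₁⟩ := (h 0).forces_phase (d := fun _ _ => 0) (θ := 0)
    (fun _ _ _ => rfl) (fun _ _ _ => Nat.zero_le _)
    (fun a b ho => by
      have := hlong a b (hne (by have := ho.1; have := ho.2; omega))
      have := hY (Outgoing grp 0) (rk a b)
      omega)
    (fun a b ha _ => by omega) (fun a b ha _ => by omega)
  have hm₁ : ∀ a b, grp a = 0 → 0 < grp b →
      θ₁ + 7 * lowerSum N.len rk (fun _ _ => True) (rk a b) + 6 ≤ d₁ a b := fun a b ha hb => by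
    have h1 := hlong a b (hne (by omega))
    have h2 := hY (Outgoing grp 0) (rk a b)
    have h3 := hout₁ a b ⟨ha, hb⟩
    omega
  have hR : ∀ a b, grp a = 0 → grp b = 2 →
      lowerSum N.len rk (Closing grp 1) R + lowerSum N.len rk (Outgoing grp 1) R ≤
        2 * lowerSum N.len rk (fun _ _ => True) (rk a b) := fun a b ha hb => by
    have h1 : lowerSum N.len rk (Closing grp 1) R ≤ lowerSum N.len rk (fun _ _ => True) (rk a b) :=
      lowerSum_mono fun a' b' hab hF _ => ⟨trivial, hrank a b a' b' ha hb hab (Or.inl hF)⟩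
    have h2 : lowerSum N.len rk (Outgoing grp 1) R ≤ lowerSum N.len rk (fun _ _ => True) (rk a b) :=
      lowerSum_mono fun a' b' hab hF _ => ⟨trivial, hrank a b a' b' ha hb hab (Or.inr hF)⟩
    omega
  obtain ⟨θ₂, d₂, hθ₂, hf₂, hd₂, hlen₂, hout₂⟩ := (h 1).forces_phase (d := d₁) (θ := θ₁)
    (fun v hv u => hd₁ v u (fun ho => by have := ho.1; omega)) hlen₁
    (fun a b ho => by
      have := hlong a b (hne (by have := ho.1; have := ho.2; omega))
      have := hY (Outgoing grp 1) (rk a b)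
      omega)
    (fun a b ha hb => by
      have := hm₁ a b (by omega) (by omega)
      have := hY (Closing grp 1) (rk a b)
      omega)
    (fun a b ha hb => by
      have := hm₁ a b (by omega) (by omega)
      have := hR a b (by omega) (by have := hgrp b; omega)
      omega)
  obtain ⟨θ₃, d₃, -, hf₃, -⟩ := (h 2).forces_phase (d := d₂) (θ := θ₂)
    (fun v hv u => (hd₂ v u (fun ho => by have := ho.1; omega)).trans
      (hd₁ v u (fun ho => by have := ho.1; omega))) hlen₂
    (fun a b ho => by
      have := ho.2
      have := hgrp b
      omega)
    (fun a b ha hb => by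
      have h1 := hY (Closing grp 2) (rk a b)
      rcases (show grp a = 0 ∨ grp a = 1 by omega) with ha | ha
      · have := hm₁ a b ha (by omega)
        have := hR a b ha hb
        rw [hd₂ a b (fun ho => by have := ho.1; omega)]
        omega
      · have := hout₂ a b ⟨ha, by omega⟩
        have := hY (Outgoing grp 1) (rk a b)
        have := hlong a b (hne (by omega))
        omega)
    (fun a b ha hb => by have := hgrp b; omega)
  refine Forces.searcherWins ((hf₁.trans (hf₂.trans hf₃)).mono_right ?_) ?_
  · rintro x (⟨v, hv, rfl⟩ | ⟨u, v, t, -, -, -, -, hE, -⟩)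
    · have := hgrp v
      simp only [Set.mem_ofPred_eq] at hv
      omega
    · have := hgrp u
      have := hgrp v
      simp only [Open] at hE
      omega
  · intro x
    rcases (h 0).covers.vertex x with ⟨a, rfl⟩ | ⟨a, b, t, hab, ht0, ht, rfl⟩
    · exact Or.inl ⟨a, Nat.zero_le _, rfl⟩
    · refine Or.inr ⟨a, b, t, hab, ht0, ht, rfl, ?_, Nat.zero_le _, Nat.zero_le _⟩
      simp only [Open]; omega

/-- Lengths that grow geometrically with the rank exceed any fixed multiple of the total
length of the paths of smaller rank. -/
theorem lowerSum_geometric {l m : V → V → ℕ} {L : ℕ} (hm : ∀ a b, m a b ≤ L)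
    (hl : ∀ a b, l a b = m a b * (8 * (8 * L + 1) ^ rk a b))
    (hinj : ∀ a b a' b', a < b → a' < b' → rk a b = rk a' b' → a = a' ∧ b = b') (r : ℕ) :
    8 * lowerSum l rk (fun _ _ => True) r + 8 ≤ 8 * (8 * L + 1) ^ r := by
  classical
  have key : lowerSum l rk (fun _ _ => True) r ≤
      ∑ j ∈ Finset.range r, L * (8 * (8 * L + 1) ^ j) := by
    induction r with
    | zero => simp [lowerSum]
    | succ r ih =>
      rw [Finset.sum_range_succ]
      by_cases hex : ∃ a b, a < b ∧ rk a b = r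
      · obtain ⟨a, b, hab, hr⟩ := hex
        have hsub : lowerSum l rk (fun _ _ => True) (r + 1) ≤
            l a b + lowerSum l rk (fun _ _ => True) r := by
          have hnot : (a, b) ∉ Finset.univ.filter
            (fun p : V × V => p.1 < p.2 ∧ True ∧ rk p.1 p.2 < r) := by simp [hr]
          have h := Finset.sum_insert (f := fun p : V × V => l p.1 p.2) hnot
          simp only [lowerSum]
          rw [← h]
          refine Finset.sum_le_sum_of_subset fun p hp => ?_
          simp only [Finset.mem_insert, Finset.mem_filter, Finset.mem_univ, true_and] at hp ⊢
          rcases (Nat.lt_succ_iff.1 hp.2).lt_or_eq with h1 | h1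
          · exact Or.inr ⟨hp.1, h1⟩
          · obtain ⟨h2, h3⟩ := hinj _ _ _ _ hp.1 hab (h1.trans hr.symm)
            exact Or.inl (Prod.ext h2 h3)
        have hlab : l a b ≤ L * (8 * (8 * L + 1) ^ r) := by
          rw [hl, hr]; exact Nat.mul_le_mul_right _ (hm a b)
        omega
      · have hsub : lowerSum l rk (fun _ _ => True) (r + 1) ≤
            lowerSum l rk (fun _ _ => True) r :=
          lowerSum_mono fun a b hab _ hr => ⟨trivial, lt_of_le_of_ne (by omega)
            fun h => hex ⟨a, b, hab, h⟩⟩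
        omega
  have h1 := geom_identity L r
  have h2 : ∑ j ∈ Finset.range r, L * (8 * (8 * L + 1) ^ j) =
      8 * L * ∑ j ∈ Finset.range r, (8 * L + 1) ^ j := by
    rw [Finset.mul_sum]
    exact Finset.sum_congr rfl fun _ _ => by ring
  rw [h2] at key
  omega

end Upper

theorem inspectionNumber_le {V : Type u} {G : SimpleGraph V} {k : ℕ} (h : SearcherWins G k) :
    inspectionNumber G ≤ k := iInf₂_le k h

theorem card_group_le {n q : ℕ} (hq : n ≤ 3 * q) (p : ℕ) :
    (Finset.univ.filter fun v : Fin n => (v : ℕ) / q = p).card ≤ q := by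
  rcases Nat.eq_zero_or_pos q with rfl | hq0
  · exact (Finset.card_le_univ _).trans (by simpa using hq)
  · have hsub : (Finset.univ.filter fun v : Fin n => (v : ℕ) / q = p).card ≤
        (Finset.Ico (q * p) (q * p + q)).card := by
      refine Finset.card_le_card_of_injOn (fun v => (v : ℕ)) (fun v hv => ?_)
        (fun v _ w _ h => Fin.ext h)
      simp only [Finset.coe_filter, Finset.mem_univ, true_and, Set.mem_ofPred_eq] at hv
      simp only [Finset.coe_Ico, Set.mem_Ico, ← hv]
      have := Nat.div_add_mod (v : ℕ) q
      have := Nat.mod_lt (v : ℕ) hq0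
      omega
    simpa using hsub

/-- The bound for complete graphs, with `q` standing for the size of three groups that contain all
vertices. -/
theorem hasSearchableSubdivisions_completeGraph {n q : ℕ} (hq : n ≤ 3 * q) :
    HasSearchableSubdivisions (SimpleGraph.completeGraph (Fin n)) ((q + 2 : ℕ) : ℕ∞) := by
  classical
  rintro W _ H ⟨S⟩
  let N : Net (⊤ : SimpleGraph (Fin n)) H := S.toNet
  have hN : N.Covers := S.toNet_covers
  let grp : Fin n → ℕ := fun v => v / q
  -- pairs in lexicographic order, those between the first and the last group on top
  let rk : Fin n → Fin n → ℕ := fun u v =>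
    (if grp (min u v) = 0 ∧ grp (max u v) = 2 then n * n else 0) +
      ((min u v : Fin n) * n + (max u v : Fin n))
  obtain ⟨L, hL⟩ : ∃ L, ∀ a b, N.len a b ≤ L :=
    ⟨∑ a, ∑ b, N.len a b, fun a b =>
      (Finset.single_le_sum (f := fun b => N.len a b) (fun _ _ => Nat.zero_le _)
        (Finset.mem_univ b)).trans (Finset.single_le_sum (f := fun a => ∑ b, N.len a b)
          (fun _ _ => Nat.zero_le _) (Finset.mem_univ a))⟩
  have hrks : ∀ u v, rk u v = rk v u := fun u v => by simp only [rk, min_comm, max_comm]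
  have hlow : ∀ u v : Fin n, (u : ℕ) * n + v < n * n := fun u v => by
    have h1 : ((u : ℕ) + 1) * n ≤ n * n := Nat.mul_le_mul_right _ u.2
    have := v.2
    linarith [Nat.succ_mul (u : ℕ) n]
  have hrki : ∀ a b a' b' : Fin n, a < b → a' < b' → rk a b = rk a' b' → a = a' ∧ b = b' := by
    intro a b a' b' hab hab' he
    simp only [rk, min_eq_left hab.le, max_eq_right hab.le, min_eq_left hab'.le,
      max_eq_right hab'.le] at he
    have h1 := hlow a b
    have h2 := hlow a' b'
    have h3 : (a : ℕ) * n + b = a' * n + b' := by split_ifs at he <;> omega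
    have hn : 0 < n := a.pos
    have h4 : (a : ℕ) = a' := by
      have := congrArg (· / n) h3
      simpa [Nat.div_eq_of_lt, Nat.mul_add_div hn, Nat.mul_comm _ n] using this
    refine ⟨Fin.ext h4, Fin.ext ?_⟩
    rw [h4] at h3
    omega
  -- by `lowerSum_geometric` these factors make every path long compared with those of lower rank
  obtain ⟨W', hW', H', N', hsub, hcov, hlen⟩ := N.exists_refinement hN
    (fun a b => 8 * (8 * L + 1) ^ rk a b) (fun a b => by simp only [hrks a b])
    (fun a b => by positivity)
  refine ⟨W', hW', H', hsub, inspectionNumber_le ?_⟩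
  have hlong : ∀ a b : Fin n, a ≠ b →
      8 * lowerSum N'.len rk (fun _ _ => True) (rk a b) + 8 ≤ N'.len a b := fun a b hab => by
    refine (lowerSum_geometric hL hlen hrki (rk a b)).trans ?_
    rw [hlen]
    exact Nat.le_mul_of_pos_left _ (N.len_pos hab)
  have hmono : Monotone grp := fun u v huv => Nat.div_le_div_right huv
  refine searcherWins_of_groups (N := N') (grp := grp) (rk := rk) (R := n * n + n * n)
    (fun p => ⟨hcov, fun u v huv => ?_, hmono, hrks, hrki, fun u v => ?_, ?_⟩) (fun v => ?_) ?_
    hlong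
  · have := hlong u v huv
    omega
  · have := hlow (min u v) (max u v)
    simp only [rk]
    split_ifs <;> omega
  · exact Nat.add_le_add_right (card_group_le hq p) 2
  · have := v.2
    exact Nat.div_lt_of_lt_mul (by omega)
  · intro a b a' b' ha hb hab' hF
    have hab : a < b := lt_of_not_ge fun hle => by have := hmono hle; omega
    have h1 := hlow a' b'
    have h2 : ¬ (grp a' = 0 ∧ grp b' = 2) := by
      rintro ⟨h3, h4⟩
      rcases hF with hF | hF
      · simp only [Closing] at hF; omega
      · have := hF.1; omega
    simp only [rk, min_eq_left hab.le, max_eq_right hab.le, min_eq_left hab'.le,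
      max_eq_right hab'.le, ha, hb, h2]
    simp
    omega

theorem isSubdivision_refl {V : Type u} (G : SimpleGraph V) : IsSubdivision G G := by
  let N : Net G G :=
    { br := id
      len := fun _ _ => 1
      pos := fun a b t => if t = 0 then a else b
      br_inj := Function.injective_id
      len_pos := fun _ => one_pos
      len_symm := fun _ _ => rfl
      pos_zero := fun _ => rfl
      pos_symm := fun {a b t} _ ht => by
        rcases (show t = 0 ∨ t = 1 by omega) with rfl | rfl <;> rfl
      adj := fun {a b t} h ht => by
        obtain rfl : t = 0 := by omega
        exact h
      br_ne := fun _ _ h0 h1 => by omega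
      inj := fun _ _ h0 h1 => by omega }
  exact N.isSubdivision ⟨fun x => Or.inl ⟨x, rfl⟩,
    fun {x y} h => ⟨x, y, 0, h, one_pos, rfl, rfl⟩⟩

/-- No complete graph on at least five vertices has topological inspection number below `4`. -/
theorem four_le_topInspectionNumber_completeGraph {n : ℕ} (hn : 5 ≤ n) :
    4 ≤ topInspectionNumber (SimpleGraph.completeGraph (Fin n)) := by
  refine le_sInf fun k hk => ?_
  obtain ⟨W', _, H', ⟨S⟩, hle⟩ := hk (Fin n) _ (isSubdivision_refl _)
  refine le_trans (le_iInf₂ fun j hj => ?_) hle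
  by_contra hlt
  have hj3 : j ≤ 3 := by
    have : (j : ℕ∞) < ((4 : ℕ) : ℕ∞) := lt_of_not_ge hlt
    have := Nat.cast_lt.1 this
    omega
  exact (S.toNet.comap (G' := (⊤ : SimpleGraph (Fin 5))) (Fin.castLE hn)
    (Fin.castLE_injective hn) (fun h => by simpa using h)).not_searcherWins hj3 hj

end InspectionGame


theorem mainTheorem7 :
    (∀ n : ℕ, InspectionGame.topInspectionNumber (SimpleGraph.completeGraph (Fin n)) ≤
      ((⌈(n : ℚ) / 3⌉₊ + 2 : ℕ) : ℕ∞)) ∧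
    InspectionGame.topInspectionNumber (SimpleGraph.completeGraph (Fin 5)) = 4 ∧
    InspectionGame.topInspectionNumber (SimpleGraph.completeGraph (Fin 6)) = 4 := by
  have hle : ∀ n q : ℕ, n ≤ 3 * q →
      InspectionGame.topInspectionNumber (SimpleGraph.completeGraph (Fin n)) ≤ ((q + 2 : ℕ) : ℕ∞) :=
    fun n q h => sInf_le (InspectionGame.hasSearchableSubdivisions_completeGraph h)
  refine ⟨fun n => hle n _ ?_, le_antisymm ?_ ?_, le_antisymm ?_ ?_⟩
  · have h := Nat.le_ceil ((n : ℚ) / 3)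
    rw [div_le_iff₀ (by norm_num)] at h
    have h' : (n : ℚ) ≤ ((3 * ⌈(n : ℚ) / 3⌉₊ : ℕ) : ℚ) := by push_cast; linarith
    exact_mod_cast h'
  · exact_mod_cast hle 5 2 (by norm_num)
  · exact InspectionGame.four_le_topInspectionNumber_completeGraph le_rfl
  · exact_mod_cast hle 6 2 (by norm_num)
  · exact InspectionGame.four_le_topInspectionNumber_completeGraph (by norm_num)
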